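/- Let $\Bbbk$ be a field of characteristic $0$ and let $n>1$ be an integer. A conformal algebra is a $\Bbbk$-space $C$ with a linear map $D:C\to C$ and bilinear products $a\circ_m b$, $m\in\mathbb Z_{\ge 0}$, such that for all $a,b\in C$: $a\circ_m b=0$ for all sufficiently large $m$; $Da\circ_m b=-m\,a\circ_{m-1}b$; $a\circ_m Db=D(a\circ_m b)+m\,a\circ_{m-1}b$. It is $\mathbb Z_2$-graded if $C=C_0\oplus C_1$ with $DC_i\subseteq C_i$ and $C_i\circ_m C_j\subseteq C_{i+j \bmod 2}$; write $p(a)=i$ for $a\in C_i$. Put $\{b\circ_m a\}=\sum_{s\ge0}\frac{(-1)^{m+s}}{s!}D^s(b\circ_{m+s}a)$. A superinvolution of $C$ is a $\Bbbk[D]$-linear map $\sigma:C\to C$ preserving parity, with $\sigma^2=\mathrm{id}_C$ and $\sigma(a\circ_m b)=(-1)^{p(a)p(b)}\{\sigma(b)\circ_m\sigma(a)\}$ for all homogeneous $a,b\in C$ and all $m\ge0$. Let $V=\Bbbk[D]\otimes\bigwedge_n$, where $\bigwedge_n=\bigwedge(\xi_1,\dots,\xi_n)$ is the Grassmann algebra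 with its basis $e_1,\dots,e_{2^n}$ of monomials $\xi_I$, $I\subseteq\{1,\dots,n\}$, listed in any order with $e_1=1$; $V=V_0\oplus V_1$ is graded by $p(\xi_I)=|I|\bmod 2$, $p(D)=0$. Let $\mathrm{Cend}_{2^n}=\mathrm{Cend}\,V$ be the conformal algebra of all $\Bbbk$-linear maps $a:\Bbbk[D]\to\mathrm{End}_{\Bbbk}V$ such that for every $v\in V$ one has $a(D^m)v=0$ for all sufficiently large $m$, and $a(h)Dv=Da(h)v+a(h')v$ for all $h\in\Bbbk[D]$, $v\in V$, with operations $(Da)(h)=-a(h')$ and $(a\circ_m b)(h)=\sum_{s\ge0}(-1)^s\binom ms a(D^{m-s})b(D^sh)$. Let $Q=Q(v)=\mathrm{diag}(v,1,\dots,1)$ be of size $2^n$, and let $Q(D):V\to V$ be the $\Bbbk[D]$-linear map with matrix $Q(D)$ in the basis $e_1,\dots,e_{2^n}$. Let $\mathrm{Cend}_{2^n,Q}\subseteq\mathrm{Cend}_{2^n}$ be the conformal subalgebra of all maps $h\mapsto a(h)\circ Q(D)$, $a\in\mathrm{Cend}_{2^n}$ (it corresponds to $M_{2^n}(\Bbbk[D,v])\,Q(v-D)$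 under the identification $\mathrm{Cend}_{2^n}\simeq M_{2^n}(\Bbbk[D,v])$). It is $\mathbb Z_2$-graded: $c$ has parity $j$ if $c(h)V_i\subseteq V_{i+j \bmod 2}$ for all $h\in\Bbbk[D]$ and all $i$. Then the $\mathbb Z_2$-graded associative conformal algebra $\mathrm{Cend}_{2^n,Q}$ has no superinvolution. -/

import Mathlib

open Polynomial

/-- A conformal algebra over a field `k` : a `k`-linear space `C` with a linear map `D` and bilinear
products `a ∘ₙ b = prod n a b`, `n ≥ 0`, satisfying locality and sesquilinearity. (For `n = 0` the
terms with the truncated index `n - 1` have coefficient `0`.) -/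
class ConformalAlgebra (k : Type*) (C : Type*) [Field k] [AddCommGroup C] [Module k C] where
  /-- the derivation `D` -/
  D : C →ₗ[k] C
  /-- the `n`-th product -/
  prod : ℕ → C →ₗ[k] C →ₗ[k] C
  locality : ∀ a b : C, ∃ N : ℕ, ∀ n, N ≤ n → prod n a b = 0
  D_prod : ∀ (n : ℕ) (a b : C), prod n (D a) b = -((n : k) • prod (n - 1) a b)
  prod_D : ∀ (n : ℕ) (a b : C), prod n a (D b) = D (prod n a b) + (n : k) • prod (n - 1) a b

namespace ConformalAlgebra

/-- A `ℤ/2`-grading `C = C₀ ⊕ C₁` of a conformal algebra. -/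
structure Grading (k : Type*) (C : Type*) [Field k] [AddCommGroup C] [Module k C]
    [ConformalAlgebra k C] where
  /-- the homogeneous components -/
  part : ZMod 2 → Submodule k C
  isInternal : DirectSum.IsInternal part
  D_mem : ∀ (i : ZMod 2) (a : C), a ∈ part i → D (k := k) a ∈ part i
  prod_mem : ∀ (i j : ZMod 2) (n : ℕ) (a b : C), a ∈ part i → b ∈ part j →
    prod (k := k) n a b ∈ part (i + j)

/-- `{a ∘ₙ b} = ∑_{s ≥ 0} (-1)^(n+s) / s! • D^s (a ∘ₙ₊ₛ b)`. The sum is finite by locality. -/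
noncomputable def braceProd (k : Type*) {C : Type*} [Field k] [AddCommGroup C] [Module k C]
    [ConformalAlgebra k C] (n : ℕ) (a b : C) : C :=
  ∑ᶠ s : ℕ, ((-1 : k) ^ (n + s) / (s.factorial : k)) •
    ((D (k := k) (C := C)) ^ s) (prod (k := k) (n + s) a b)

/-- A superinvolution of a `ℤ/2`-graded conformal algebra: a `k[D]`-linear map `σ` (that is,
`k`-linear and commuting with `D`) preserving parity, with `σ² = id` and
`σ (a ∘ₙ b) = (-1)^(p(a)p(b)) {σ(b) ∘ₙ σ(a)}` for homogeneous `a`, `b`. -/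
structure IsSuperinvolution {k : Type*} {C : Type*} [Field k] [AddCommGroup C] [Module k C]
    [ConformalAlgebra k C] (G : Grading k C) (σ : C →ₗ[k] C) : Prop where
  map_D : ∀ a : C, σ (D (k := k) a) = D (k := k) (σ a)
  map_part : ∀ (i : ZMod 2) (a : C), a ∈ G.part i → σ a ∈ G.part i
  invol : ∀ a : C, σ (σ a) = a
  map_prod : ∀ (i j : ZMod 2) (a b : C), a ∈ G.part i → b ∈ G.part j → ∀ n : ℕ,
    σ (prod (k := k) n a b) = ((-1 : k) ^ (i.val * j.val)) • braceProd k n (σ b) (σ a)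

end ConformalAlgebra

theorem sum_choose_left {k M : Type*} [Field k] [AddCommGroup M] [Module k M] (n : ℕ)
    (F : ℕ → ℕ → M) :
    ∑ s ∈ Finset.range (n + 1), ((-1 : k) ^ s * (n.choose s : k)) •
      (((n - s : ℕ) : k) • F (n - s - 1) s) =
    (n : k) • ∑ s ∈ Finset.range (n - 1 + 1), ((-1 : k) ^ s * ((n - 1).choose s : k)) •
      F (n - 1 - s) s := by
  cases n with
  | zero => simp
  | succ m =>
    rw [Finset.sum_range_succ]
    simp only [Nat.sub_self, Nat.cast_zero, zero_smul, smul_zero, add_zero, Nat.add_sub_cancel,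
      Finset.smul_sum]
    refine Finset.sum_congr rfl fun s hs => ?_
    have hs' : s ≤ m := by simpa [Nat.lt_succ_iff] using hs
    have h1 : m + 1 - s - 1 = m - s := by omega
    have h2 : ((m + 1).choose s : k) * ((m + 1 - s : ℕ) : k) = ((m + 1 : ℕ) : k) * m.choose s := by
      have := Nat.choose_mul_succ_eq m s
      rw [← Nat.cast_mul, ← Nat.cast_mul]
      exact congrArg Nat.cast (by rw [← this]; ring)
    rw [h1, smul_smul, smul_smul, mul_assoc, h2]
    congr 1
    ring

theorem sum_choose_right {k M : Type*} [Field k] [AddCommGroup M] [Module k M] (n : ℕ)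
    (F : ℕ → ℕ → M) :
    ∑ s ∈ Finset.range (n + 1), ((-1 : k) ^ s * (n.choose s : k)) •
      ((s : k) • F (n - s) (s - 1)) =
    -((n : k) • ∑ s ∈ Finset.range (n - 1 + 1), ((-1 : k) ^ s * ((n - 1).choose s : k)) •
      F (n - 1 - s) s) := by
  cases n with
  | zero => simp
  | succ m =>
    rw [Finset.sum_range_succ']
    simp only [Nat.cast_zero, zero_smul, smul_zero, add_zero, Nat.add_sub_cancel,
      Finset.smul_sum]
    rw [← Finset.sum_neg_distrib]
    refine Finset.sum_congr rfl fun s hs => ?_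
    have h1 : m + 1 - (s + 1) = m - s := by omega
    have h2 : ((m + 1).choose (s + 1) : k) * ((s + 1 : ℕ) : k) =
        ((m + 1 : ℕ) : k) * m.choose s := by
      rw [← Nat.cast_mul, ← Nat.cast_mul]
      exact congrArg Nat.cast (Nat.add_one_mul_choose_eq m s).symm
    rw [h1, smul_smul, smul_smul, mul_assoc, h2, ← neg_smul]
    congr 1
    ring

section ConformalEndomorphisms

variable (k : Type*) [Field k] (V : Type*) [AddCommGroup V] [Module k V] [Module k[X] V]
  [IsScalarTower k k[X] V]

/-- Conformal endomorphisms of a `k[D]`-module `V` (`D` is the polynomial variable `X`): `k`-linear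
maps `a : k[D] → End_k V` such that for every `v` one has `a(Dᵐ)v = 0` for all large `m`, and
`a(h)(Dv) = D(a(h)v) + a(h')v`. -/
def CendSubmodule : Submodule k (k[X] →ₗ[k] Module.End k V) where
  carrier := {a | (∀ v : V, ∃ M : ℕ, ∀ m, M ≤ m → a (X ^ m) v = 0) ∧
    ∀ (h : k[X]) (v : V), a h ((X : k[X]) • v) = (X : k[X]) • a h v + a (derivative h) v}
  zero_mem' := by
    refine ⟨fun v => ⟨0, fun m _ => by simp⟩, fun h v => by simp⟩
  add_mem' := by
    rintro a b ⟨ha, ha'⟩ ⟨hb, hb'⟩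
    refine ⟨fun v => ?_, fun h v => ?_⟩
    · obtain ⟨M, hM⟩ := ha v
      obtain ⟨M', hM'⟩ := hb v
      refine ⟨max M M', fun m hm => ?_⟩
      simp [hM m (le_trans (le_max_left _ _) hm), hM' m (le_trans (le_max_right _ _) hm)]
    · simp only [LinearMap.add_apply, ha', hb', smul_add]
      abel
  smul_mem' := by
    rintro c a ⟨ha, ha'⟩
    refine ⟨fun v => ?_, fun h v => ?_⟩
    · obtain ⟨M, hM⟩ := ha v
      exact ⟨M, fun m hm => by simp [hM m hm]⟩
    · simp only [LinearMap.smul_apply, ha', smul_add]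
      rw [smul_comm c (X : k[X])]

/-- The space `Cend V` of conformal endomorphisms of `V`. -/
def Cend : Type _ := ↥(CendSubmodule k V)

noncomputable instance : AddCommGroup (Cend k V) :=
  inferInstanceAs (AddCommGroup ↥(CendSubmodule k V))

noncomputable instance : Module k (Cend k V) :=
  inferInstanceAs (Module k ↥(CendSubmodule k V))

variable {k V}

namespace Cend

/-- The underlying map of a conformal endomorphism: `act a h = a(h)`. -/
noncomputable def act : Cend k V →ₗ[k] k[X] →ₗ[k] Module.End k V := (CendSubmodule k V).subtype

/-- The conformal endomorphism with a given underlying map. -/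
def mk (a : k[X] →ₗ[k] Module.End k V)
    (h1 : ∀ v : V, ∃ M : ℕ, ∀ m, M ≤ m → a (X ^ m) v = 0)
    (h2 : ∀ (h : k[X]) (v : V),
      a h ((X : k[X]) • v) = (X : k[X]) • a h v + a (derivative h) v) : Cend k V :=
  ⟨a, h1, h2⟩

@[simp] theorem act_mk (a : k[X] →ₗ[k] Module.End k V) (h1 h2) : act (mk a h1 h2) = a := rfl

theorem act_local (a : Cend k V) (v : V) : ∃ M : ℕ, ∀ m, M ≤ m → act a (X ^ m) v = 0 :=
  a.2.1 v

theorem act_X_smul (a : Cend k V) (h : k[X]) (v : V) :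
    act a h ((X : k[X]) • v) = (X : k[X]) • act a h v + act a (derivative h) v :=
  a.2.2 h v

@[ext] theorem ext {a b : Cend k V} (H : ∀ h v, act a h v = act b h v) : a = b :=
  Subtype.ext (LinearMap.ext fun h => LinearMap.ext fun v => H h v)

theorem derivative_X_pow_smul (m : ℕ) : derivative (X ^ m : k[X]) = (m : k) • X ^ (m - 1) := by
  rw [derivative_X_pow, smul_eq_C_mul]

/-- `(Da)(h) = -a(h')`. -/
noncomputable def deriv : Cend k V →ₗ[k] Cend k V where
  toFun a := mk (-(act a ∘ₗ derivative))
    (fun v => by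
      obtain ⟨M, hM⟩ := act_local a v
      refine ⟨M + 1, fun m hm => ?_⟩
      simp only [LinearMap.neg_apply, LinearMap.comp_apply, derivative_X_pow_smul, map_smul,
        LinearMap.smul_apply, hM (m - 1) (by omega), smul_zero, neg_zero])
    (fun h v => by
      simp only [LinearMap.neg_apply, LinearMap.comp_apply, act_X_smul, smul_neg]
      abel)
  map_add' a b := by
    ext h v
    simp only [map_add, act_mk, LinearMap.neg_apply, LinearMap.comp_apply, LinearMap.add_apply]
    abel
  map_smul' c a := by
    ext h v
    simp

@[simp] theorem deriv_apply (a : Cend k V) (h : k[X]) (v : V) :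
    act (deriv a) h v = -act a (derivative h) v := rfl

/-- `(a ∘ₙ b)(h) = ∑_{s ≥ 0} (-1)^s (n choose s) a(D^(n-s)) b(D^s h)`. -/
noncomputable def mul (n : ℕ) : Cend k V →ₗ[k] Cend k V →ₗ[k] Cend k V :=
  LinearMap.mk₂ k
    (fun a b => mk (∑ s ∈ Finset.range (n + 1), ((-1 : k) ^ s * (n.choose s : k)) •
        ((LinearMap.mulLeft k (act a (X ^ (n - s)))) ∘ₗ
          act b ∘ₗ (LinearMap.mulLeft k (X ^ s : k[X]))))
      (fun v => by
        obtain ⟨M, hM⟩ := act_local b v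
        refine ⟨M, fun m hm => ?_⟩
        simp only [LinearMap.sum_apply, LinearMap.smul_apply, LinearMap.comp_apply,
          LinearMap.mulLeft_apply, Module.End.mul_apply, ← pow_add]
        exact Finset.sum_eq_zero fun s _ => by rw [hM (s + m) (by omega)]; simp)
      (fun h v => by
        have h1 := sum_choose_left (k := k) n fun i j => act a (X ^ i) (act b (X ^ j * h) v)
        have h2 := sum_choose_right (k := k) n fun i j => act a (X ^ i) (act b (X ^ j * h) v)
        simp only [LinearMap.sum_apply, LinearMap.smul_apply, LinearMap.comp_apply,
          LinearMap.mulLeft_apply, Module.End.mul_apply, act_X_smul, map_add, derivative_mul,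
          derivative_X_pow_smul, LinearMap.add_apply, map_smul, smul_mul_assoc, smul_add,
          Finset.sum_add_distrib, Finset.smul_sum] at h1 h2 ⊢
        rw [h1, h2]
        simp only [smul_comm (X : k[X]) (_ : k)]
        abel))
    (fun a a' b => by
      ext h v
      simp [LinearMap.sum_apply, Finset.sum_add_distrib])
    (fun c a b => by
      ext h v
      simp [LinearMap.sum_apply, Finset.smul_sum, smul_smul, mul_comm])
    (fun a b b' => by
      ext h v
      simp [LinearMap.sum_apply, Finset.sum_add_distrib])
    (fun c a b => by
      ext h v
      simp [LinearMap.sum_apply, Finset.smul_sum, smul_smul, mul_comm])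

theorem mul_apply (n : ℕ) (a b : Cend k V) (h : k[X]) (v : V) :
    act (mul n a b) h v =
      ∑ s ∈ Finset.range (n + 1), ((-1 : k) ^ s * (n.choose s : k)) •
        act a (X ^ (n - s))
          (act b (X ^ s * h) v) := by
  simp [mul, LinearMap.sum_apply]

theorem mul_deriv_left (n : ℕ) (a b : Cend k V) :
    mul n (deriv a) b = -((n : k) • mul (n - 1) a b) := by
  ext h v
  have h1 := sum_choose_left (k := k) n fun i j =>
    act a (X ^ i) (act b (X ^ j * h) v)
  simp only [map_neg, map_smul, LinearMap.neg_apply, LinearMap.smul_apply,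
    mul_apply, deriv_apply, derivative_X_pow_smul, smul_neg, Finset.sum_neg_distrib, h1]

theorem mul_deriv_right (n : ℕ) (a b : Cend k V) :
    mul n a (deriv b) = deriv (mul n a b) + (n : k) • mul (n - 1) a b := by
  ext h v
  have h2 := sum_choose_right (k := k) n fun i j =>
    act a (X ^ i) (act b (X ^ j * h) v)
  simp only [map_add, map_smul, LinearMap.add_apply, LinearMap.smul_apply,
    mul_apply, deriv_apply, derivative_mul, derivative_X_pow_smul, map_neg,
    smul_mul_assoc, smul_neg, smul_add, neg_add, Finset.sum_neg_distrib,
    Finset.sum_add_distrib, h2]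
  abel

/-- A conformal endomorphism is determined by its action on generators of `V`. -/
theorem eq_zero_of_span (c : Cend k V) (S : Set V) (hS : Submodule.span k[X] S = ⊤)
    (hc : ∀ (h : k[X]), ∀ v ∈ S, act c h v = 0) : c = 0 := by
  ext h v
  have hv : v ∈ Submodule.span k[X] S := hS ▸ Submodule.mem_top
  rw [map_zero, LinearMap.zero_apply, LinearMap.zero_apply]
  induction hv using Submodule.span_induction generalizing h with
  | mem x hx => exact hc h x hx
  | zero => simp
  | add x y _ _ hx hy => rw [map_add, hx h, hy h, add_zero]
  | smul p x _ hx =>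
    induction p using Polynomial.induction_on generalizing h with
    | C r => rw [← mul_one (C r), ← smul_eq_C_mul, smul_assoc, one_smul, map_smul, hx h, smul_zero]
    | add p q hp hq => rw [add_smul, map_add, hp h, hq h, add_zero]
    | monomial m r ih =>
      have : C r * X ^ (m + 1) = X * (C r * X ^ m) := by ring
      rw [this, mul_smul, act_X_smul, ih, ih, smul_zero, add_zero]

theorem locality [Module.Finite k[X] V] (a b : Cend k V) :
    ∃ N : ℕ, ∀ n, N ≤ n → mul n a b = 0 := by
  obtain ⟨S, hS⟩ := (Module.Finite.fg_top : (⊤ : Submodule k[X] V).FG)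
  have hb : ∃ M : ℕ, ∀ v ∈ S, ∀ m, M ≤ m →
      act b (X ^ m) v = 0 := by
    choose f hf using act_local b
    exact ⟨S.sup f, fun v hv m hm => hf v m (le_trans (Finset.le_sup hv) hm)⟩
  obtain ⟨M, hM⟩ := hb
  have ha : ∃ M' : ℕ, ∀ v ∈ S, ∀ j < M, ∀ m, M' ≤ m →
      act a (X ^ m)
        (act b (X ^ j) v) = 0 := by
    choose f hf using act_local a
    refine ⟨S.sup fun v => (Finset.range M).sup fun j =>
      f (act b (X ^ j) v), fun v hv j hj m hm => hf _ m ?_⟩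
    refine le_trans (le_trans ?_ (Finset.le_sup (f := fun v => (Finset.range M).sup fun j =>
      f (act b (X ^ j) v)) hv)) hm
    exact Finset.le_sup (f := fun j => f (act b (X ^ j) v))
      (Finset.mem_range.2 hj)
  obtain ⟨M', hM'⟩ := ha
  refine ⟨M + M', fun n hn => eq_zero_of_span _ (S : Set V) hS fun h v hv => ?_⟩
  induction h using Polynomial.induction_on' with
  | add p q hp hq => rw [map_add, LinearMap.add_apply, hp, hq, add_zero]
  | monomial i r =>
    rw [← C_mul_X_pow_eq_monomial, ← smul_eq_C_mul, map_smul, LinearMap.smul_apply, mul_apply]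
    rw [Finset.sum_eq_zero, smul_zero]
    intro s _
    rw [← pow_add]
    by_cases hs : s + i < M
    · rw [hM' v hv (s + i) hs (n - s) (by omega), smul_zero]
    · rw [hM v hv (s + i) (by omega), map_zero, smul_zero]

/-- `Cend V` is a conformal algebra when `V` is a finitely generated `k[D]`-module. -/
noncomputable instance [Module.Finite k[X] V] : ConformalAlgebra k (Cend k V) where
  D := deriv
  prod := mul
  locality := locality
  D_prod := mul_deriv_left
  prod_D := mul_deriv_right

/-- For `k[D]`-linear maps `S T : V → V`, the conformal endomorphism `h ↦ S ∘ a(h) ∘ T`. -/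
noncomputable def sandwich (S T : V →ₗ[k[X]] V) : Cend k V →ₗ[k] Cend k V where
  toFun a := mk ((LinearMap.mulLeft k (S.restrictScalars k : Module.End k V)) ∘ₗ
      (LinearMap.mulRight k (T.restrictScalars k : Module.End k V)) ∘ₗ act a)
    (fun v => by
      obtain ⟨M, hM⟩ := act_local a (T v)
      exact ⟨M, fun m hm => by simp [hM m hm]⟩)
    (fun h v => by simp [act_X_smul])
  map_add' a b := by
    ext h v
    change S (act (a + b) h (T v)) = S (act a h (T v)) + S (act b h (T v))
    simp
  map_smul' c a := by
    ext h v
    change S (act (c • a) h (T v)) = c • S (act a h (T v))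
    simp

@[simp] theorem sandwich_apply (S T : V →ₗ[k[X]] V) (a : Cend k V) (h : k[X]) (v : V) :
    act (sandwich S T a) h v =
      S (act a h (T v)) := rfl

end Cend

end ConformalEndomorphisms

section CendQ

variable {k : Type*} [Field k] {ι : Type*} [Fintype ι] [DecidableEq ι]

/-- `Cend_{N,Q}`, where `N = |ι|` and `Q = Q(v)` is an `N × N` matrix over `k[v]`: the set of all
`h ↦ a(h) ∘ Q(D)`, where `a` runs through `Cend_N = Cend V`, `V = k[D] ⊗ k^N = k[D]^N`.

Under the identification of `M_N(k[D, v])` with `Cend_N` that lets `1 ⊗ A vʲ` act by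
`(1 ⊗ A vʲ)(h) u = h(0) Dʲ A u` for `u ∈ k^N`, right multiplication by `Q(v - D)` becomes
composition with `Q(D)`, so this is `M_N(k[D, v]) Q(v - D)`. -/
noncomputable def CendQ (Q : Matrix ι ι k[X]) : Submodule k (Cend k (ι → k[X])) :=
  LinearMap.range (Cend.sandwich LinearMap.id (Matrix.toLin' Q))

namespace CendQ

theorem deriv_mem (Q : Matrix ι ι k[X]) {a : Cend k (ι → k[X])} (ha : a ∈ CendQ Q) :
    Cend.deriv a ∈ CendQ Q := by
  obtain ⟨a, rfl⟩ := ha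
  refine ⟨Cend.deriv a, ?_⟩
  ext1 h v
  rfl

theorem mul_mem (Q : Matrix ι ι k[X]) (n : ℕ) (a : Cend k (ι → k[X])) {b : Cend k (ι → k[X])}
    (hb : b ∈ CendQ Q) : Cend.mul n a b ∈ CendQ Q := by
  obtain ⟨b, rfl⟩ := hb
  refine ⟨Cend.mul n a b, ?_⟩
  ext1 h v
  simp only [Cend.sandwich_apply, Cend.mul_apply, LinearMap.id_apply]

/-- `Cend_{N,Q}` is a conformal subalgebra of `Cend_N`. -/
noncomputable instance (Q : Matrix ι ι k[X]) : ConformalAlgebra k (CendQ Q) where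
  D := Cend.deriv.restrict fun _ ha => deriv_mem Q ha
  prod n := LinearMap.mk₂ k (fun a b => ⟨Cend.mul n a.1 b.1, mul_mem Q n a.1 b.2⟩)
    (fun a a' b => Subtype.ext (by simp)) (fun c a b => Subtype.ext (by simp))
    (fun a b b' => Subtype.ext (by simp)) (fun c a b => Subtype.ext (by simp))
  locality a b := by
    obtain ⟨N, hN⟩ := Cend.locality a.1 b.1
    exact ⟨N, fun n hn => Subtype.ext (hN n hn)⟩
  D_prod n a b := Subtype.ext (Cend.mul_deriv_left n a.1 b.1)
  prod_D n a b := Subtype.ext (Cend.mul_deriv_right n a.1 b.1)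

end CendQ

/-- Given parities `p x` of the basis vectors `e_x`, the component `V_i` of `V = k[D] ⊗ k^N`: the
`k[D]`-span of the basis vectors of parity `i`. -/
def homogeneousVectors (k : Type*) [Field k] {ι : Type*} (p : ι → ZMod 2) (i : ZMod 2) :
    Submodule k[X] (ι → k[X]) where
  carrier := {u | ∀ x, p x ≠ i → u x = 0}
  zero_mem' := fun _ _ => rfl
  add_mem' := fun hu hv x hx => by simp [hu x hx, hv x hx]
  smul_mem' := fun c u hu x hx => by simp [hu x hx]

namespace CendQ

/-- The elements of `Cend_{N,Q}` of parity `j`: those with `a(h) V_i ⊆ V_{i+j}`. -/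
def parityPart (Q : Matrix ι ι k[X]) (p : ι → ZMod 2) (j : ZMod 2) : Submodule k (CendQ Q) where
  carrier := {a | ∀ (h : k[X]) (i : ZMod 2), ∀ u ∈ homogeneousVectors k p i,
    Cend.act a.1 h u ∈ homogeneousVectors k p (i + j)}
  zero_mem' := fun _ _ _ _ => Submodule.zero_mem _
  add_mem' := fun ha hb h i u hu => Submodule.add_mem _ (ha h i u hu) (hb h i u hu)
  smul_mem' := fun c a ha h i u hu => by
    have := Submodule.smul_mem _ (C c) (ha h i u hu)
    rw [← mul_one (C c), ← smul_eq_C_mul, smul_assoc, one_smul] at this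
    exact this

/-- The projection of `V` onto `V_i`. -/
noncomputable def parityProj (k : Type*) [Field k] {ι : Type*} (p : ι → ZMod 2) (i : ZMod 2) :
    (ι → k[X]) →ₗ[k[X]] (ι → k[X]) where
  toFun u x := if p x = i then u x else 0
  map_add' u v := by
    ext1 x
    by_cases hx : p x = i <;> simp [hx]
  map_smul' c u := by
    ext1 x
    by_cases hx : p x = i <;> simp [hx]

theorem parityProj_mem (p : ι → ZMod 2) (i : ZMod 2) (u : ι → k[X]) :
    parityProj k p i u ∈ homogeneousVectors k p i := fun x hx => by
  simp [parityProj, hx]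

theorem parityProj_add (p : ι → ZMod 2) (i : ZMod 2) (u : ι → k[X]) :
    parityProj k p i u + parityProj k p (i + 1) u = u := by
  ext1 x
  have h : ∀ a b : ZMod 2, (a = b ∧ a ≠ b + 1) ∨ (a ≠ b ∧ a = b + 1) := by decide
  rcases h (p x) i with ⟨h1, h2⟩ | ⟨h1, h2⟩ <;> simp [parityProj, h1, h2]

theorem parityProj_of_mem (p : ι → ZMod 2) (i j : ZMod 2) (u : ι → k[X])
    (hu : u ∈ homogeneousVectors k p i) : parityProj k p j u = if i = j then u else 0 := by
  ext1 x
  by_cases hx : p x = i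
  · subst hx
    by_cases h : p x = j <;> simp [parityProj, h]
  · have := hu x hx
    by_cases h : i = j <;> simp [parityProj, h, this]

theorem parityProj_comm (Q : Matrix ι ι k[X]) (p : ι → ZMod 2)
    (hQ : ∀ x y, p x ≠ p y → Q x y = 0) (i : ZMod 2) (u : ι → k[X]) :
    parityProj k p i (Matrix.toLin' Q u) = Matrix.toLin' Q (parityProj k p i u) := by
  ext1 x
  simp only [parityProj, LinearMap.coe_mk, AddHom.coe_mk, Matrix.toLin'_apply, Matrix.mulVec,
    dotProduct]
  by_cases hx : p x = i
  · rw [if_pos hx]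
    refine Finset.sum_congr rfl fun y _ => ?_
    by_cases hy : p y = i
    · rw [if_pos hy]
    · rw [if_neg hy, hQ x y (by rw [hx]; exact fun h => hy h.symm)]
      simp
  · rw [if_neg hx]
    symm
    refine Finset.sum_eq_zero fun y _ => ?_
    by_cases hy : p y = i
    · rw [hQ x y (by rw [hy]; exact hx)]
      simp
    · rw [if_neg hy, mul_zero]

theorem parityPart_isInternal (Q : Matrix ι ι k[X]) (p : ι → ZMod 2)
    (hQ : ∀ x y, p x ≠ p y → Q x y = 0) : DirectSum.IsInternal (parityPart Q p) := by
  rw [DirectSum.isInternal_submodule_iff_isCompl (parityPart Q p) (i := 0) (j := 1) (by decide)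
    (by ext i; revert i; decide)]
  constructor
  · rw [Submodule.disjoint_def]
    intro a h0 h1
    apply Subtype.ext
    ext1 h v
    have key : ∀ i, ∀ u ∈ homogeneousVectors k p i,
        Cend.act a.1 h u = 0 := fun i u hu => by
      have e0 := parityProj_of_mem p _ i _ (h0 h i u hu)
      have e1 := parityProj_of_mem p _ i _ (h1 h i u hu)
      rw [if_pos (add_zero i)] at e0
      rw [if_neg (by clear e0 e1 hu; revert i; decide)] at e1
      rw [← e0, e1]
    rw [← parityProj_add p 0 v, map_add, key _ _ (parityProj_mem p _ v),
      key _ _ (parityProj_mem p _ v)]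
    simp
  · rw [codisjoint_iff, eq_top_iff]
    rintro ⟨a, ha⟩ -
    have hmem : ∀ i j, Cend.sandwich (parityProj k p i) (parityProj k p j) a ∈ CendQ Q := by
      obtain ⟨b, rfl⟩ := ha
      refine fun i j => ⟨Cend.sandwich (parityProj k p i) (parityProj k p j) b, ?_⟩
      ext1 h v
      simp only [Cend.sandwich_apply, LinearMap.id_apply, parityProj_comm Q p hQ]
    have hpart : ∀ i j : ZMod 2, (⟨_, hmem (i + j) i⟩ : CendQ Q) ∈ parityPart Q p j := by
      intro i j h l u hu
      simp only [Cend.sandwich_apply]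
      rw [parityProj_of_mem p l i u hu]
      by_cases hl : l = i
      · subst hl
        exact parityProj_mem p _ _
      · rw [if_neg hl, map_zero, map_zero]
        exact Submodule.zero_mem _
    refine Submodule.mem_sup.2 ⟨_, Submodule.add_mem _ (hpart 0 0) (hpart 1 0), _,
      Submodule.add_mem _ (hpart 0 1) (hpart 1 1), ?_⟩
    apply Subtype.ext
    ext1 h v
    simp only [Submodule.coe_add, map_add, LinearMap.add_apply, Cend.sandwich_apply]
    have e1 := parityProj_add p 0 (Cend.act a h
      (parityProj k p 0 v))
    have e2 := parityProj_add p 1 (Cend.act a h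
      (parityProj k p 1 v))
    have e3 := congrArg (Cend.act a h) (parityProj_add p 0 v)
    rw [map_add] at e3
    simp only [zero_add, add_zero] at e1 e2 e3 ⊢
    refine Eq.trans ?_ ((congrArg₂ (· + ·) e1 e2).trans e3)
    abel

/-- If the matrix `Q` is even, then `Cend_{N,Q}` inherits from `V = V₀ ⊕ V₁` the grading by
parity. -/
noncomputable def grading (Q : Matrix ι ι k[X]) (p : ι → ZMod 2)
    (hQ : ∀ x y, p x ≠ p y → Q x y = 0) : ConformalAlgebra.Grading k (CendQ Q) where
  part := parityPart Q p
  isInternal := parityPart_isInternal Q p hQ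
  D_mem := fun j a ha h i u hu => Submodule.neg_mem _ (ha (derivative h) i u hu)
  prod_mem := fun i j n a b ha hb h l u hu => by
    change Cend.act (Cend.mul n a.1 b.1) h u ∈ _
    rw [Cend.mul_apply]
    refine Submodule.sum_mem _ fun s _ => ?_
    have h1 := ha (X ^ (n - s)) _ _ (hb (X ^ s * h) l u hu)
    have h2 := Submodule.smul_mem _ (C ((-1 : k) ^ s * (n.choose s : k))) h1
    rw [← mul_one (C _), ← smul_eq_C_mul, smul_assoc, one_smul, add_assoc, add_comm j i] at h2
    exact h2

end CendQ

end CendQ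

/-- The matrix `diag(v, 1, …, 1)` of size `N`. -/
noncomputable def diagV (k : Type*) [Field k] (N : ℕ) : Matrix (Fin N) (Fin N) k[X] :=
  Matrix.diagonal fun i => if (i : ℕ) = 0 then X else 1

/-- Let the basis `e_x`, `x : Fin (2 ^ n)`, of `⋀(ξ₁, …, ξₙ)` be formed by the monomials `ξ_I`,
`I ⊆ {1, …, n}`, enumerated by `e` (so that `e_x = ξ_{e x}`). The parity of `ξ_I` is `|I|` modulo
`2`; it yields the canonical grading on `⋀ₙ`, hence on `V = k[D] ⊗ ⋀ₙ` and on `Cend_{2^n, Q}`,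
`Q = diag(v, 1, …, 1)`. -/
noncomputable def exteriorGrading (k : Type*) [Field k] (n : ℕ)
    (e : Fin (2 ^ n) ≃ Finset (Fin n)) :
    ConformalAlgebra.Grading k (CendQ (diagV k (2 ^ n))) :=
  CendQ.grading (diagV k (2 ^ n)) (fun x => ((e x).card : ZMod 2)) fun x y hxy => by
    have h : x ≠ y := fun h => hxy (by rw [h])
    simp [diagV, h]

/-! Modulo the image of `D`, an element `a` of the conformal algebra is determined by the
`k[D]`-linear map `a(1)`, and the product of index 0 becomes composition. The brace of index 0
differs from that product by an element of the image of `D`, so a superinvolution induces an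
anti-involution on the quotient of the even part. This quotient is a sum of two blocks: M_m(k[X]) Q₀
on V₀, where Q₀ = diag(X, 1, …, 1), and M_m(k[X]) on V₁, with m = 2^(n-1). The second block has an
identity and the first has none, so they cannot be mixed (`evenBlock_eq_zero`). What remains is an
anti-involution τ of the matrices M_m(k[X]) with the product A Q₀ B.

Conjugating left multiplication by `D` with σ gives a map that respects left and right
multiplication on the even block, hence is multiplication by a polynomial q. The product of index 1
shows q' = -1 (`exists_conj_leftX`). So τ is semilinear over the substitution θ : X ↦ q.

A rank-one argument gives τ(A) = C θ(A)ᵀ B with B Q₀ C = θ(Q₀) (`Matrix.exists_form_of_antihom`).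
From τ² = id one gets C θ(B)ᵀ = c with c² = 1, and then det C · det B = c^m = 1 because m is even,
which is where n > 1 enters. Determinants of B Q₀ C = θ(Q₀) now give X = θ(X) = q, contrary to q' =
-1 (`Matrix.eq_X_of_antiinvolution`). For odd m the value c = -1 would only give θ(X) = -X, which is
consistent with q' = -1. -/

/-! ### Rank-one matrices over a principal ideal domain. -/

/-- Over a principal ideal domain, a nonzero vector is a multiple of a unimodular one. -/
theorem exists_eq_smul_unimodular {R ι : Type*} [CommRing R] [IsDomain R] [IsPrincipalIdealRing R]
    [Fintype ι] (v : ι → R) (hv : v ≠ 0) :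
    ∃ (g : R) (u y : ι → R), v = g • u ∧ y ⬝ᵥ u = 1 := by
  obtain ⟨g, hg⟩ := IsPrincipalIdealRing.principal (Ideal.span (Set.range v))
  have h1 : ∀ i, ∃ c, v i = g * c := fun i => by
    have : v i ∈ Ideal.span (Set.range v) := Ideal.subset_span ⟨i, rfl⟩
    rw [hg, Ideal.submodule_span_eq, Ideal.mem_span_singleton] at this
    exact this
  choose u hu using h1
  have h2 : g ∈ Ideal.span (Set.range v) := by
    rw [hg]
    exact Submodule.mem_span_singleton_self g
  obtain ⟨y, hy⟩ := (Ideal.mem_span_range_iff_exists_fun).1 h2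
  have hg0 : g ≠ 0 := by
    rintro rfl
    exact hv (funext fun i => by simp [hu i])
  refine ⟨g, u, y, funext fun i => by simp [hu i], mul_left_cancel₀ hg0 ?_⟩
  rw [mul_one, dotProduct, Finset.mul_sum]
  refine Eq.trans (Finset.sum_congr rfl fun i _ => ?_) hy
  rw [hu i]
  ring

/-- Over a principal ideal domain, a matrix with a nonzero multiple of rank one is the product of a
unimodular column and a row. -/
theorem Matrix.exists_eq_vecMulVec_unimodular {R m n : Type*} [CommRing R] [IsDomain R]
    [IsPrincipalIdealRing R] [Fintype m] (F : Matrix m n R) (c : R) (hc : c ≠ 0)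
    (v : m → R) (hv : v ≠ 0) (w : n → R) (h : c • F = Matrix.vecMulVec v w) :
    ∃ (u y : m → R) (w' : n → R), y ⬝ᵥ u = 1 ∧ F = Matrix.vecMulVec u w' := by
  obtain ⟨g, u, y, rfl, hy⟩ := exists_eq_smul_unimodular v hv
  refine ⟨u, y, Matrix.vecMul y F, hy, ?_⟩
  -- The row `y F` has entries in `R` itself; unimodularity of `u` thus avoids dividing `w` by `c`.
  have key : c • Matrix.vecMul y F = g • w := by
    rw [← Matrix.vecMul_smul, h, Matrix.vecMul_vecMulVec, dotProduct_smul, hy]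
    simp
  have h' : c • F = c • Matrix.vecMulVec u (Matrix.vecMul y F) := by
    rw [← Matrix.vecMulVec_smul, key, h]
    ext i l
    simp [Matrix.vecMulVec_apply]
    ring
  ext i l
  exact mul_left_cancel₀ hc (congrFun (congrFun h' i) l)

/-! ### Semilinear anti-involutions of matrices with the product A Q B. -/

section TwistedInvolution

variable {k J : Type*} [Field k] [Fintype J] [DecidableEq J] {d : J → k[X]}
  {θ : k[X] →ₐ[k] k[X]} {τ : Matrix J J k[X] →+ Matrix J J k[X]}

/-- A `θ`-semilinear anti-endomorphism of the algebra of matrices with the product `A Q B`, where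
`Q` is diagonal with some entry `1`, has the form `A ↦ C θ(A)ᵀ B`. -/
theorem Matrix.exists_form_of_antihom (hd : ∀ x, d x ≠ 0) (j : J) (hj : d j = 1)
    (τ_smul : ∀ q A, τ (q • A) = θ q • τ A)
    (τ_mul : ∀ A B, τ (A * Matrix.diagonal d * B) = τ B * Matrix.diagonal d * τ A)
    (τ_surj : Function.Surjective τ) (τ_inj : Function.Injective τ) :
    ∃ C B : Matrix J J k[X], (∀ A, τ A = C * (A.map θ).transpose * B) ∧
      B * Matrix.diagonal d * C = (Matrix.diagonal d).map θ := by
  set D := Matrix.diagonal d with hD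
  set E : J → J → Matrix J J k[X] := fun a b => Matrix.single a b 1 with hE
  have hEE : ∀ (a b c e : J) (Y : Matrix J J k[X]), E a b * Y * E c e = Y b c • E a e := by
    intro a b c e Y
    simp [hE, Matrix.single_mul_mul_single, Matrix.smul_single]
  have hDj : D j j = 1 := by simp [hD, hj]
  have hvv : ∀ (a b a' b' : J → k[X]) (Y : Matrix J J k[X]),
      Matrix.vecMulVec a b * Y * Matrix.vecMulVec a' b' =
        (Matrix.vecMul b Y ⬝ᵥ a') • Matrix.vecMulVec a b' := by
    intro a b a' b' Y
    rw [Matrix.vecMulVec_mul, Matrix.vecMulVec_mul_vecMulVec, Matrix.vecMulVec_smul]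
  set F := τ (E j j) with hF
  have hF0 : F ≠ 0 := fun h => by
    have h1 : E j j = 0 := τ_inj (by rw [← hF, h, map_zero])
    have h2 := congrFun (congrFun h1 j) j
    simp [hE] at h2
  -- Since `d j = 1`, the unit `E j j` is idempotent for the twisted product and cuts out a corner
  -- of rank one; surjectivity of `τ` transfers both facts to `F`.
  have hFF : F * D * F = F := by rw [hF, ← τ_mul, hEE, hDj, one_smul]
  have hFX : ∀ X, ∃ c : k[X], F * D * X * D * F = c • F := by
    intro X
    obtain ⟨Y, rfl⟩ := τ_surj X
    refine ⟨θ ((D * Y * D) j j), ?_⟩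
    rw [hF, ← τ_smul, ← hEE, Matrix.mul_assoc (τ (E j j) * D), Matrix.mul_assoc (τ (E j j) * D),
      ← τ_mul, ← τ_mul]
    simp only [Matrix.mul_assoc]
  obtain ⟨a, b, hab⟩ : ∃ a b, F a b ≠ 0 := by
    by_contra! h
    exact hF0 (Matrix.ext h)
  -- With `E b a` in the middle, the product is column `b` of `F D` times row `a` of `D F`; its `(a,
  -- b)` entry is nonzero, so `c ≠ 0` and `F` has rank one.
  obtain ⟨c, hc⟩ := hFX (E b a)
  have hc' : c • F = Matrix.vecMulVec (fun i => F i b * d b) (fun l => d a * F a l) := by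
    rw [← hc]
    ext i l
    rw [Matrix.mul_assoc _ D F]
    simp [hE, hD, Matrix.mul_apply, Matrix.single_apply, Matrix.vecMulVec_apply,
      Matrix.diagonal_apply, ite_and]
  have hc0 : c ≠ 0 := by
    rintro rfl
    have := congrFun (congrFun hc' a) b
    simp [Matrix.vecMulVec_apply, hab, hd] at this
  obtain ⟨u, y, w, hy, huw⟩ := F.exists_eq_vecMulVec_unimodular c hc0 _
    (fun h => mul_ne_zero hab (hd b) (congrFun h a)) _ hc'
  have smul_F : ∀ s t : k[X], s • F = t • F → s = t := fun s t h =>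
    mul_right_cancel₀ hab (congrFun (congrFun h a) b)
  have hs : Matrix.vecMul w D ⬝ᵥ u = 1 := smul_F _ _ (by rw [one_smul, huw, ← hvv, ← huw, hFF])
  -- `E j l` absorbs `E j j` on the left, so its image absorbs `F = u w` on the right; `hrow` is the
  -- mirror case.
  have hcol : ∀ l, τ (E j l) = Matrix.vecMulVec ((τ (E j l) * D).mulVec u) w := fun l => by
    rw [← Matrix.mul_vecMulVec, ← huw, hF, ← τ_mul, hEE, hDj, one_smul]
  have hrow : ∀ i, τ (E i j) = Matrix.vecMulVec u (Matrix.vecMul w (D * τ (E i j))) := fun i => by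
    rw [← Matrix.vecMulVec_mul, ← huw, ← Matrix.mul_assoc, hF, ← τ_mul, hEE, hDj, one_smul]
  generalize hC : (fun l => (τ (E j l) * D).mulVec u) = C at hcol
  generalize hB : (fun i => Matrix.vecMul w (D * τ (E i j))) = B at hrow
  have hcol' : ∀ l, τ (E j l) = Matrix.vecMulVec (C l) w := fun l => by rw [← hC]; exact hcol l
  have hrow' : ∀ i, τ (E i j) = Matrix.vecMulVec u (B i) := fun i => by rw [← hB]; exact hrow i
  have hτE : ∀ i l, τ (E i l) = Matrix.vecMulVec (C l) (B i) := fun i l => by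
    rw [← one_smul k[X] (E i l), ← hDj, ← hEE, τ_mul, hcol', hrow', hvv, hs, one_smul]
  refine ⟨Matrix.of fun x l => C l x, Matrix.of B, fun A => ?_, ?_⟩
  · induction A using Matrix.induction_on' with
    | h_zero => simp
    | h_add p q hp hq =>
      rw [map_add, hp, hq, Matrix.map_add _ (map_add θ), Matrix.transpose_add, Matrix.mul_add,
        Matrix.add_mul]
    | h_std_basis i l q =>
      have : Matrix.single i l q = q • E i l := by simp [hE, Matrix.smul_single]
      rw [this, τ_smul, hτE]
      ext x y
      simp [hE, Matrix.mul_apply, Matrix.vecMulVec_apply, Matrix.single_apply, ite_and]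
      ring_nf
  -- The image of `E j l * D * E i j = D l i • E j j` under `τ` compares coefficients of `F`.
  · ext1 i l
    refine smul_F _ _ ?_
    have h1 : D l i • E j j = E j l * D * E i j := (hEE _ _ _ _ _).symm
    have h2 := congrArg τ h1
    rw [τ_smul, τ_mul, ← hF, hrow', hcol', hvv, ← huw] at h2
    have h3 : D l i = D i l := by
      rw [hD, ← Matrix.diagonal_transpose, Matrix.transpose_apply, Matrix.diagonal_transpose]
    rw [Matrix.map_apply, ← h3, h2]
    congr 1

/-- There is no `θ`-semilinear anti-involution, `θ ≠ id`, of the algebra of matrices of even size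
with the product `A Q B`, where `Q = diag(X, 1, …, 1)`. -/
theorem Matrix.eq_X_of_antiinvolution (hJ : Even (Fintype.card J)) (o j : J) (hjo : j ≠ o)
    (ho : d o = X) (hd : ∀ x, x ≠ o → d x = 1)
    (τ_smul : ∀ q A, τ (q • A) = θ q • τ A)
    (τ_mul : ∀ A B, τ (A * Matrix.diagonal d * B) = τ B * Matrix.diagonal d * τ A)
    (τ_invol : Function.Involutive τ) : θ X = X := by
  have hd0 : ∀ x, d x ≠ 0 := fun x => by
    by_cases hx : x = o
    · rw [hx, ho]
      exact X_ne_zero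
    · rw [hd x hx]
      exact one_ne_zero
  obtain ⟨C, B, hτ, hBC⟩ := Matrix.exists_form_of_antihom hd0 j (hd j hjo) τ_smul τ_mul
    τ_invol.surjective τ_invol.injective
  have hθθ : ∀ q, θ (θ q) = q := fun q => by
    have h := τ_invol (q • 1)
    rw [τ_smul, τ_smul, τ_invol] at h
    simpa using congrFun (congrFun h o) o
  have hθu : ∀ q : k[X], IsUnit q → θ q = q := fun q hq => by
    obtain ⟨r, -, rfl⟩ := Polynomial.isUnit_iff.1 hq
    exact θ.commutes r
  have hmap : ∀ A : Matrix J J k[X], (A.map θ).map θ = A := fun A => by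
    ext1 x y
    exact hθθ _
  set S := C * (B.map θ).transpose with hS
  set S' := (C.map θ).transpose * B with hS'
  -- The square of A ↦ C θ(A)ᵀ B is A ↦ S A S'; being the identity, it forces `S` to be a scalar
  -- unit.
  have hSS' : ∀ A, S * A * S' = A := fun A => by
    refine Eq.trans ?_ (τ_invol A)
    rw [hτ (τ A), hτ A, Matrix.map_mul, Matrix.map_mul, Matrix.transpose_mul, Matrix.transpose_mul,
      Matrix.transpose_map (f := θ) (M := A.map θ), Matrix.transpose_transpose, hmap]
    simp only [hS, hS', Matrix.mul_assoc]
  have hent : ∀ a b x y, S x a * S' b y = Matrix.single a b (1 : k[X]) x y := fun a b x y => by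
    rw [← hSS' (Matrix.single a b 1)]
    simp [Matrix.mul_apply, Matrix.single_apply, ite_and]
  have h1 : ∀ x y, S x x * S' y y = 1 := fun x y => by rw [hent]; simp
  set c := S o o with hc
  have hcu : IsUnit c := IsUnit.of_mul_eq_one _ (h1 o o)
  have hS0 : S' o o ≠ 0 := right_ne_zero_of_mul_eq_one (h1 o o)
  have hSc : S = c • 1 := by
    ext1 x a
    refine mul_right_cancel₀ hS0 ?_
    by_cases hx : a = x
    · subst hx
      simp [h1, hc]
    · rw [hent, Matrix.single_apply_of_row_ne hx]
      simp [Matrix.one_apply_ne' hx]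
  have hBC' : B * (C.map θ).transpose = c • 1 := by
    have h2 := congrArg (fun M : Matrix J J k[X] => (M.map θ).transpose) hSc
    rw [hS, Matrix.map_mul, Matrix.transpose_mul, Matrix.transpose_map, hmap,
      Matrix.transpose_transpose] at h2
    rw [h2]
    ext1 x y
    by_cases hx : x = y
    · subst hx
      simp [hθu c hcu]
    · simp [Matrix.one_apply_ne hx, Matrix.one_apply_ne' hx]
  -- S S' = 1 times θ(C)ᵀ on the right reads c² θ(C)ᵀ = θ(C)ᵀ, and θ(C) is nonzero because B θ(C)ᵀ =
  -- c.
  have hcc : c ^ 2 = 1 := by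
    have h2 := congrArg (· * (C.map θ).transpose) (hSS' 1)
    simp only [Matrix.mul_one, Matrix.one_mul] at h2
    rw [hSc, hS', Matrix.smul_mul, Matrix.one_mul, Matrix.smul_mul, Matrix.mul_assoc, hBC',
      Matrix.mul_smul, Matrix.mul_one, smul_smul, ← sq] at h2
    by_contra hne
    have h3 : (C.map θ).transpose = 0 := by
      ext1 x y
      have h4 := congrFun (congrFun h2 x) y
      rw [Matrix.smul_apply, smul_eq_mul, mul_left_eq_self₀] at h4
      exact h4.resolve_left hne
    rw [h3, Matrix.mul_zero] at hBC'
    have h5 := congrFun (congrFun hBC' o) o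
    simp only [Matrix.zero_apply, Matrix.smul_apply, Matrix.one_apply_eq, smul_eq_mul,
      mul_one] at h5
    exact hcu.ne_zero h5.symm
  have hcn : c ^ Fintype.card J = 1 := by
    obtain ⟨m, hm⟩ := hJ
    rw [hm, ← two_mul, pow_mul, hcc, one_pow]
  have hdet1 : B.det * (C.map θ).det = 1 := by
    rw [← Matrix.det_transpose (C.map θ), ← Matrix.det_mul, hBC', Matrix.det_smul, Matrix.det_one,
      mul_one, hcn]
  -- By `hdet1`, `B.det` is a unit, hence a constant fixed by `θ`, so the twist in det C · θ(det B)
  -- disappears.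
  have hdet2 : C.det * B.det = 1 := by
    rw [← hθu B.det (IsUnit.of_mul_eq_one _ hdet1), AlgHom.map_det, AlgHom.mapMatrix_apply,
      ← Matrix.det_transpose (B.map θ), ← Matrix.det_mul, ← hS, hSc, Matrix.det_smul,
      Matrix.det_one, mul_one, hcn]
  have hdet3 : (Matrix.diagonal d).det = X := by
    rw [Matrix.det_diagonal, Finset.prod_eq_single o (fun x _ hx => hd x hx) (by simp), ho]
  have hdet4 := congrArg Matrix.det hBC
  rw [← AlgHom.mapMatrix_apply, ← AlgHom.map_det, hdet3, Matrix.det_mul, Matrix.det_mul,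
    hdet3] at hdet4
  rw [← hdet4]
  linear_combination X * hdet2

end TwistedInvolution

/-! ### The brace products. -/

namespace ConformalAlgebra

variable {k C : Type*} [Field k] [AddCommGroup C] [Module k C] [ConformalAlgebra k C]

/-- Any large truncation is allowed, so that two braces can be compared on a common range. -/
theorem braceProd_eq_sum (n : ℕ) (a b : C) : ∃ N : ℕ, ∀ M, N ≤ M → braceProd k n a b =
    ∑ s ∈ Finset.range M, ((-1 : k) ^ (n + s) / (s.factorial : k)) •
      ((D (k := k) (C := C)) ^ s) (prod (k := k) (n + s) a b) := by
  obtain ⟨N, hN⟩ := locality (k := k) a b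
  refine ⟨N, fun M hM => finsum_eq_sum_of_support_subset _ fun s hs => ?_⟩
  rw [Finset.coe_range, Set.mem_Iio]
  by_contra hs'
  refine hs ?_
  dsimp only
  rw [hN (n + s) (by omega), map_zero, smul_zero]

theorem map_braceProd (L : C →ₗ[k] C) (hL : ∀ a, L (D (k := k) a) = D (k := k) (L a))
    {a b a' b' : C} (h : ∀ m, L (prod (k := k) m a b) = prod (k := k) m a' b') (n : ℕ) :
    L (braceProd k n a b) = braceProd k n a' b' := by
  obtain ⟨N, hN⟩ := braceProd_eq_sum (k := k) n a b
  obtain ⟨N', hN'⟩ := braceProd_eq_sum (k := k) n a' b'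
  have hpow : ∀ (s : ℕ) (c : C), L (((D (k := k) (C := C)) ^ s) c) =
      ((D (k := k) (C := C)) ^ s) (L c) := by
    intro s
    induction s with
    | zero => intro c; simp
    | succ s ih => intro c; rw [pow_succ', Module.End.mul_apply, hL, ih, Module.End.mul_apply]
  rw [hN _ (le_max_left N N'), hN' _ (le_max_right N N'), map_sum]
  exact Finset.sum_congr rfl fun s _ => by rw [map_smul, hpow, h]

/-- Only the term `s = 0` lies outside the image of `D`. Hence σ reverses the 0-th product modulo
that image. -/
theorem braceProd_zero_eq_add_D (a b : C) :
    ∃ c, braceProd k 0 a b = prod (k := k) 0 a b + D (k := k) c := by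
  obtain ⟨N, hN⟩ := braceProd_eq_sum (k := k) 0 a b
  refine ⟨∑ s ∈ Finset.range N, ((-1 : k) ^ (s + 1) / ((s + 1).factorial : k)) •
      ((D (k := k) (C := C)) ^ s) (prod (k := k) (s + 1) a b), ?_⟩
  rw [hN (N + 1) (Nat.le_succ N), Finset.sum_range_succ', map_sum, add_comm]
  congr 1
  · simp
  · refine Finset.sum_congr rfl fun s _ => ?_
    rw [map_smul, pow_succ', Module.End.mul_apply, zero_add]

end ConformalAlgebra

/-! ### Values at 1, the image of the derivation, and the identity of Cend. -/

namespace Cend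

section

variable {k : Type*} [Field k] {V : Type*} [AddCommGroup V] [Module k V] [Module k[X] V]
  [IsScalarTower k k[X] V]

theorem act_one_smul (a : Cend k V) (q : k[X]) (v : V) : act a 1 (q • v) = q • act a 1 v := by
  induction q using Polynomial.induction_on with
  | C r => rw [← mul_one (C r), ← smul_eq_C_mul, smul_assoc, one_smul, map_smul, smul_assoc,
      one_smul]
  | add p q hp hq => rw [add_smul, map_add, hp, hq, add_smul]
  | monomial m r ih =>
    have : C r * X ^ (m + 1) = X * (C r * X ^ m) := by ring
    rw [this, mul_smul, act_X_smul, ih, derivative_one, map_zero, LinearMap.zero_apply, add_zero,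
      ← mul_smul]

/-- A `k`-linear section of differentiation of polynomials. -/
theorem exists_antiderivative (k : Type*) [Field k] [CharZero k] :
    ∃ I : k[X] →ₗ[k] k[X], (∀ m, ∃ r : k, I (X ^ m) = r • X ^ (m + 1)) ∧
      (∀ h, derivative (I h) = h) ∧ ∀ h, ∃ r, I (derivative h) = h - C r := by
  let I : k[X] →ₗ[k] k[X] := (Polynomial.basisMonomials k).constr k
    fun m : ℕ => ((m + 1 : k)⁻¹) • X ^ (m + 1)
  have hI : ∀ m : ℕ, I (X ^ m) = ((m + 1 : k)⁻¹) • X ^ (m + 1) := fun m => by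
    have := (Polynomial.basisMonomials k).constr_basis k
      (fun m : ℕ => ((m + 1 : k)⁻¹) • (X ^ (m + 1) : k[X])) m
    simpa only [coe_basisMonomials, monomial_one_right_eq_X_pow] using this
  have hm : ∀ m : ℕ, (m + 1 : k) ≠ 0 := fun m => by exact_mod_cast Nat.succ_ne_zero m
  refine ⟨I, fun m => ⟨_, hI m⟩, fun h => ?_, fun h => ?_⟩
  · induction h using Polynomial.induction_on' with
    | add p q hp hq => rw [map_add, map_add, hp, hq]
    | monomial m r =>
      rw [← C_mul_X_pow_eq_monomial, ← smul_eq_C_mul, map_smul, hI, derivative_smul,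
        derivative_smul, derivative_X_pow_smul]
      push_cast
      rw [smul_smul ((m + 1 : k)⁻¹), inv_mul_cancel₀ (hm m), one_smul]
  · induction h using Polynomial.induction_on' with
    | add p q hp hq =>
      obtain ⟨r, hr⟩ := hp
      obtain ⟨s, hs⟩ := hq
      exact ⟨r + s, by rw [map_add, map_add, hr, hs, C_add]; ring⟩
    | monomial m r =>
      cases m with
      | zero => exact ⟨r, by simp⟩
      | succ m =>
        refine ⟨0, ?_⟩
        rw [← C_mul_X_pow_eq_monomial, ← smul_eq_C_mul, derivative_smul, derivative_X_pow_smul,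
          map_smul, map_smul, Nat.add_sub_cancel, hI]
        push_cast
        rw [smul_smul (m + 1 : k), mul_inv_cancel₀ (hm m), one_smul, map_zero, sub_zero]

/-- A conformal endomorphism that vanishes at `1` lies in the image of the derivation. -/
theorem exists_deriv_eq [CharZero k] (a : Cend k V) (ha : act a 1 = 0) :
    ∃ c : Cend k V, deriv c = a := by
  have hC : ∀ r : k, act a (C r) = 0 := fun r => by
    rw [← mul_one (C r), ← smul_eq_C_mul, map_smul, ha, smul_zero]
  obtain ⟨I, hI, hI1, hI2⟩ := exists_antiderivative k
  have hI3 : ∀ h, act a (I (derivative h)) = act a h := fun h => by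
    obtain ⟨r, hr⟩ := hI2 h
    rw [hr, map_sub, hC, sub_zero]
  -- As `(Dc)(h) = -c(h')`, the witness is `-a ∘ I`; `I(h')` differs from `h` by a constant, which
  -- `a` kills.
  refine ⟨mk (-(act a ∘ₗ I)) (fun v => ?_) (fun h v => ?_), ?_⟩
  · obtain ⟨M, hM⟩ := act_local a v
    refine ⟨M, fun m hm => ?_⟩
    obtain ⟨r, hr⟩ := hI m
    simp only [LinearMap.neg_apply, LinearMap.comp_apply, hr, map_smul, LinearMap.smul_apply,
      hM (m + 1) (by omega), smul_zero, neg_zero]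
  · simp only [LinearMap.neg_apply, LinearMap.comp_apply, act_X_smul, hI1, hI3, smul_neg]
    abel
  · ext1 h v
    simp only [deriv_apply, act_mk, LinearMap.neg_apply, LinearMap.comp_apply, hI3, neg_neg]

end

section

variable {k : Type*} [Field k] {ι : Type*}

/-- Componentwise differentiation of vectors of polynomials. -/
noncomputable def vecDerivative (k : Type*) [Field k] (ι : Type*) : Module.End k (ι → k[X]) :=
  (derivative : k[X] →ₗ[k] k[X]).compLeft ι

theorem vecDerivative_apply (v : ι → k[X]) (x : ι) :
    vecDerivative k ι v x = derivative (v x) := rfl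

theorem vecDerivative_pow_apply (m : ℕ) (v : ι → k[X]) (x : ι) :
    (vecDerivative k ι ^ m) v x = derivative^[m] (v x) := by
  induction m generalizing v with
  | zero => rfl
  | succ m ih => rw [pow_succ, Module.End.mul_apply, ih, vecDerivative_apply,
      Function.iterate_succ_apply]

/-- The conformal endomorphism `h ↦ h(d/dD)`, the identity of `Cend_N`. -/
noncomputable def one (k : Type*) [Field k] (ι : Type*) [Fintype ι] : Cend k (ι → k[X]) :=
  mk (aeval (vecDerivative k ι)).toLinearMap
    (fun v => by
      refine ⟨(Finset.univ.sup fun x => (v x).natDegree) + 1, fun m hm => ?_⟩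
      ext1 x
      simp only [AlgHom.toLinearMap_apply, map_pow, aeval_X, vecDerivative_pow_apply, Pi.zero_apply]
      exact iterate_derivative_eq_zero (lt_of_le_of_lt
        (Finset.le_sup (f := fun x => (v x).natDegree) (Finset.mem_univ x)) hm))
    (fun h v => by
      have h1 : ∀ v, vecDerivative k ι ((X : k[X]) • v) = (X : k[X]) • vecDerivative k ι v + v := by
        intro v
        ext1 x
        simp [vecDerivative_apply, add_comm]
      simp only [AlgHom.toLinearMap_apply]
      induction h using Polynomial.induction_on generalizing v with
      | C r => simp [smul_comm (X : k[X]) r]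
      | add p q hp hq => 
        simp only [map_add, LinearMap.add_apply, hp, hq, smul_add]
        abel
      | monomial m r ih =>
        have : C r * X ^ (m + 1) = (C r * X ^ m) * X := by ring
        have h2 : derivative (C r * X ^ m * X) =
            derivative (C r * X ^ m) * X + C r * X ^ m := by
          rw [derivative_mul, derivative_X, mul_one]
        rw [this, h2, map_mul _ _ X, aeval_X, Module.End.mul_apply, h1, map_add, ih, map_add,
          map_mul _ _ X, aeval_X]
        simp only [Module.End.mul_apply, LinearMap.add_apply]
        abel)

variable [Fintype ι]

@[simp] theorem act_one_one : act (one k ι) 1 = 1 := by simp [one]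

end

end Cend

/-! ### Multiplications by `D` and the elements given by matrices. -/

namespace CendQ

open ConformalAlgebra

variable {k : Type*} [Field k] {ι : Type*} [Fintype ι] [DecidableEq ι] {Q : Matrix ι ι k[X]}

theorem coe_prod (n : ℕ) (a b : CendQ Q) :
    (prod (k := k) n a b : CendQ Q).1 = Cend.mul n a.1 b.1 := rfl

theorem coe_D (a : CendQ Q) : (D (k := k) a : CendQ Q).1 = Cend.deriv a.1 := rfl

theorem act_prod_zero (a b : CendQ Q) (h : k[X]) (v : ι → k[X]) :
    Cend.act (prod (k := k) 0 a b : CendQ Q).1 h v = Cend.act a.1 1 (Cend.act b.1 h v) := by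
  simp [coe_prod, Cend.mul_apply]

theorem act_prod_one (a b : CendQ Q) (h : k[X]) (v : ι → k[X]) :
    Cend.act (prod (k := k) 1 a b : CendQ Q).1 h v =
      Cend.act a.1 X (Cend.act b.1 h v) - Cend.act a.1 1 (Cend.act b.1 (X * h) v) := by
  simp [coe_prod, Cend.mul_apply, Finset.sum_range_succ, sub_eq_add_neg]

theorem act_D_one (a : CendQ Q) : Cend.act (D (k := k) a : CendQ Q).1 1 = 0 := by
  refine LinearMap.ext fun v => ?_
  simp [coe_D]

/-- Left multiplication `a ↦ (h ↦ D a(h))`. -/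
noncomputable def leftX (Q : Matrix ι ι k[X]) : CendQ Q →ₗ[k] CendQ Q :=
  (Cend.sandwich ((X : k[X]) • LinearMap.id) LinearMap.id).restrict fun a ha => by
    obtain ⟨a, rfl⟩ := ha
    exact ⟨Cend.sandwich ((X : k[X]) • LinearMap.id) LinearMap.id a, by ext1 h v; rfl⟩

/-- Right multiplication `a ↦ (h ↦ a(h) D)`. -/
noncomputable def rightX (Q : Matrix ι ι k[X]) : CendQ Q →ₗ[k] CendQ Q :=
  leftX Q - D (k := k)

theorem act_leftX (a : CendQ Q) (h : k[X]) (v : ι → k[X]) :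
    Cend.act (leftX Q a).1 h v = (X : k[X]) • Cend.act a.1 h v := rfl

theorem act_rightX (a : CendQ Q) (h : k[X]) (v : ι → k[X]) :
    Cend.act (rightX Q a).1 h v = Cend.act a.1 h ((X : k[X]) • v) := by
  rw [Cend.act_X_smul, rightX, LinearMap.sub_apply, Submodule.coe_sub, map_sub,
    LinearMap.sub_apply, LinearMap.sub_apply, act_leftX, coe_D, Cend.deriv_apply, sub_neg_eq_add]

theorem leftX_D (a : CendQ Q) : leftX Q (D (k := k) a) = D (k := k) (leftX Q a) := by
  apply Subtype.ext
  ext1 h v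
  simp [act_leftX, coe_D]

theorem rightX_D (a : CendQ Q) : rightX Q (D (k := k) a) = D (k := k) (rightX Q a) := by
  simp [rightX, leftX_D]

theorem leftX_prod (n : ℕ) (a b : CendQ Q) :
    leftX Q (prod (k := k) n a b) = prod (k := k) n (leftX Q a) b := by
  apply Subtype.ext
  ext1 h v
  simp only [act_leftX, coe_prod, Cend.mul_apply, Finset.smul_sum, smul_comm (X : k[X])]

theorem rightX_prod (n : ℕ) (a b : CendQ Q) :
    rightX Q (prod (k := k) n a b) = prod (k := k) n a (rightX Q b) := by
  apply Subtype.ext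
  ext1 h v
  simp only [act_rightX, coe_prod, Cend.mul_apply]

/-- For a nonsingular diagonal `Q`, an element of `Cend_{N,Q}` that vanishes at `1` lies in the
image of the derivation of `Cend_{N,Q}`. -/
theorem exists_D_eq [CharZero k] {d : ι → k[X]} (hd : ∀ x, d x ≠ 0)
    (a : CendQ (Matrix.diagonal d)) (ha : Cend.act a.1 1 = 0) :
    ∃ c : CendQ (Matrix.diagonal d), D (k := k) c = a := by
  obtain ⟨_, a, rfl⟩ := a
  have h0 : Cend.act a 1 = 0 := by
    refine LinearMap.ext fun v => ?_
    have hP : (∏ x, d x) ≠ 0 := Finset.prod_ne_zero_iff.2 fun x _ => hd x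
    -- The range of `Q` contains det(Q) V, and `a(1)` is `k[D]`-linear, so vanishing on the range
    -- already gives `a(1) = 0`.
    have hv : (∏ x, d x) • v =
        Matrix.toLin' (Matrix.diagonal d) (fun x => (∏ y ∈ Finset.univ.erase x, d y) * v x) := by
      ext1 x
      rw [Matrix.toLin'_apply, Matrix.mulVec_diagonal, ← mul_assoc,
        Finset.mul_prod_erase _ _ (Finset.mem_univ x), Pi.smul_apply, smul_eq_mul]
    have h1 : (∏ x, d x) • Cend.act a 1 v = 0 := by
      rw [← Cend.act_one_smul, hv]
      exact LinearMap.congr_fun ha _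
    ext1 x
    exact (mul_eq_zero.1 (congrFun h1 x)).resolve_left hP
  obtain ⟨c, rfl⟩ := Cend.exists_deriv_eq a h0
  refine ⟨⟨_, c, rfl⟩, Subtype.ext ?_⟩
  ext1 h v
  rfl

/-- The element `h ↦ A ∘ h(d/dD) ∘ Q` of `Cend_{N,Q}`. -/
noncomputable def ofMatrix (Q A : Matrix ι ι k[X]) : CendQ Q :=
  ⟨Cend.sandwich LinearMap.id (Matrix.toLin' Q)
    (Cend.sandwich (Matrix.toLin' A) LinearMap.id (Cend.one k ι)), _, rfl⟩

theorem act_ofMatrix (Q A : Matrix ι ι k[X]) (h : k[X]) (v : ι → k[X]) :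
    Cend.act (ofMatrix Q A).1 h v = A.mulVec (Cend.act (Cend.one k ι) h (Q.mulVec v)) := rfl

theorem act_ofMatrix_one (Q A : Matrix ι ι k[X]) (v : ι → k[X]) :
    Cend.act (ofMatrix Q A).1 1 v = A.mulVec (Q.mulVec v) := by
  rw [act_ofMatrix, Cend.act_one_one, Module.End.one_apply]

end CendQ

/-! ### The even-even block. -/

namespace CendQ

open ConformalAlgebra

variable {k : Type*} [Field k] {ι : Type*} [Fintype ι] [DecidableEq ι] {Q : Matrix ι ι k[X]}
  {p : ι → ZMod 2}

theorem act_one_apply (h : k[X]) (v : ι → k[X]) (x : ι) :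
    Cend.act (Cend.one k ι) h v x = aeval (derivative : Module.End k k[X]) h (v x) := by
  have h1 : Cend.act (Cend.one k ι) h = aeval (Cend.vecDerivative k ι) h := rfl
  rw [h1]
  induction h using Polynomial.induction_on' with
  | add q r hq hr => rw [map_add, map_add, LinearMap.add_apply, Pi.add_apply,
      hq rfl, hr rfl, LinearMap.add_apply]
  | monomial m r =>
    rw [aeval_monomial, aeval_monomial, Module.End.mul_apply, Module.End.mul_apply,
      Module.algebraMap_end_apply, Module.algebraMap_end_apply, Pi.smul_apply,
      Cend.vecDerivative_pow_apply, Module.End.pow_apply]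

theorem leftX_mem {a : CendQ Q} {i : ZMod 2} (ha : a ∈ parityPart Q p i) :
    leftX Q a ∈ parityPart Q p i := fun h l u hu =>
  Submodule.smul_mem _ X (ha h l u hu)

theorem D_mem {a : CendQ Q} {i : ZMod 2} (ha : a ∈ parityPart Q p i) :
    D (k := k) a ∈ parityPart Q p i := fun h l u hu =>
  Submodule.neg_mem _ (ha (derivative h) l u hu)

theorem rightX_mem {a : CendQ Q} {i : ZMod 2} (ha : a ∈ parityPart Q p i) :
    rightX Q a ∈ parityPart Q p i := Submodule.sub_mem _ (leftX_mem ha) (D_mem ha)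

theorem mulVec_mem {A : Matrix ι ι k[X]} (hA : ∀ x y, p x ≠ p y → A x y = 0) {i : ZMod 2}
    {u : ι → k[X]} (hu : u ∈ homogeneousVectors k p i) :
    A.mulVec u ∈ homogeneousVectors k p i := fun x hx =>
  Finset.sum_eq_zero fun y _ => by
    by_cases hy : p y = i
    · exact mul_eq_zero_of_left (hA x y fun h => hx (h.trans hy)) _
    · exact mul_eq_zero_of_right _ (hu y hy)

theorem ofMatrix_mem (hQ : ∀ x y, p x ≠ p y → Q x y = 0) {A : Matrix ι ι k[X]}
    (hA : ∀ x y, p x ≠ p y → A x y = 0) : ofMatrix Q A ∈ parityPart Q p 0 := fun h l u hu => by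
  rw [act_ofMatrix, add_zero]
  refine mulVec_mem hA fun x hx => ?_
  rw [act_one_apply, mulVec_mem hQ hu x hx, map_zero]

/-- The even-even block of the matrix of the `k[D]`-linear map `a(1)`. -/
noncomputable def evenBlock (Q : Matrix ι ι k[X]) (p : ι → ZMod 2) :
    CendQ Q →ₗ[k] Matrix {x // p x = 0} {x // p x = 0} k[X] where
  toFun a := Matrix.of fun x y => Cend.act a.1 1 (Pi.single y.1 1) x.1
  map_add' a b := by
    ext1 x y
    simp
  map_smul' c a := by
    ext1 x y
    simp

theorem evenBlock_apply (a : CendQ Q) (x y : {x // p x = 0}) :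
    evenBlock Q p a x y = Cend.act a.1 1 (Pi.single y.1 1) x.1 := rfl

theorem evenBlock_congr {a b : CendQ Q} (h : Cend.act a.1 1 = Cend.act b.1 1) :
    evenBlock Q p a = evenBlock Q p b := by
  ext1 x y
  rw [evenBlock_apply, evenBlock_apply, h]

@[simp] theorem evenBlock_D (a : CendQ Q) : evenBlock Q p (D (k := k) a) = 0 := by
  ext1 x y
  rw [evenBlock_apply, act_D_one]
  rfl

theorem evenBlock_leftX (a : CendQ Q) :
    evenBlock Q p (leftX Q a) = (X : k[X]) • evenBlock Q p a := rfl

theorem single_mem (y : {x // p x = 0}) (q : k[X]) :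
    Pi.single y.1 q ∈ homogeneousVectors k p 0 := fun x hx =>
  Pi.single_eq_of_ne (by rintro rfl; exact hx y.2) _

theorem eq_sum_single_of_mem {u : ι → k[X]} (hu : u ∈ homogeneousVectors k p 0) :
    u = ∑ z : {x // p x = 0}, u z.1 • Pi.single z.1 (1 : k[X]) := by
  ext1 x
  rw [Finset.sum_apply]
  by_cases hx : p x = 0
  · rw [Finset.sum_eq_single ⟨x, hx⟩]
    · simp
    · intro z _ hz
      rw [Pi.smul_apply, Pi.single_eq_of_ne (fun h => hz (Subtype.ext h.symm)), smul_zero]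
    · simp
  · rw [hu x hx]
    refine (Finset.sum_eq_zero fun z _ => ?_).symm
    rw [Pi.smul_apply, Pi.single_eq_of_ne (by rintro rfl; exact hx z.2), smul_zero]

theorem act_one_apply_of_mem (a : CendQ Q) {u : ι → k[X]} (hu : u ∈ homogeneousVectors k p 0)
    (x : {x // p x = 0}) :
    Cend.act a.1 1 u x.1 = ∑ z : {x // p x = 0}, evenBlock Q p a x z * u z.1 := by
  conv_lhs => rw [eq_sum_single_of_mem hu]
  rw [map_sum, Finset.sum_apply]
  refine Finset.sum_congr rfl fun z _ => ?_
  rw [Cend.act_one_smul, Pi.smul_apply, smul_eq_mul, mul_comm, evenBlock_apply]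

/-- An even `b` maps V₀ to itself, so no odd intermediate vectors contribute to the product. -/
theorem evenBlock_prod (a : CendQ Q) {b : CendQ Q} (hb : b ∈ parityPart Q p 0) :
    evenBlock Q p (prod (k := k) 0 a b) = evenBlock Q p a * evenBlock Q p b := by
  ext1 x y
  rw [evenBlock_apply, act_prod_zero, act_one_apply_of_mem a (hb 1 0 _ (single_mem y 1)),
    Matrix.mul_apply]
  rfl

theorem evenBlock_braceProd (a : CendQ Q) {b : CendQ Q} (hb : b ∈ parityPart Q p 0) :
    evenBlock Q p (braceProd k 0 a b) = evenBlock Q p a * evenBlock Q p b := by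
  obtain ⟨c, hc⟩ := braceProd_zero_eq_add_D (k := k) a b
  rw [hc, map_add, evenBlock_D, add_zero, evenBlock_prod a hb]

/-- The matrix whose even-even block is `B` and whose other entries vanish. -/
noncomputable def padMatrix (p : ι → ZMod 2)
    (B : Matrix {x // p x = 0} {x // p x = 0} k[X]) : Matrix ι ι k[X] :=
  Matrix.of fun x y => if h : p x = 0 ∧ p y = 0 then B ⟨x, h.1⟩ ⟨y, h.2⟩ else 0

theorem padMatrix_even (B : Matrix {x // p x = 0} {x // p x = 0} k[X]) (x y : ι)
    (h : p x ≠ p y) : padMatrix p B x y = 0 := by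
  rw [padMatrix, Matrix.of_apply, dif_neg]
  rintro ⟨hx, hy⟩
  exact h (hx.trans hy.symm)

variable {d : ι → k[X]}

theorem diagonal_even (x y : ι) (h : p x ≠ p y) : Matrix.diagonal d x y = 0 :=
  Matrix.diagonal_apply_ne _ fun hxy => h (by rw [hxy])

theorem act_ofMatrix_one_single (A : Matrix ι ι k[X]) (x y : ι) :
    Cend.act (ofMatrix (Matrix.diagonal d) A).1 1 (Pi.single y 1) x = A x y * d y := by
  rw [act_ofMatrix_one, Matrix.diagonal_mulVec_single, mul_one, Matrix.mulVec_single]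
  simp

theorem evenBlock_ofMatrix_padMatrix (B : Matrix {x // p x = 0} {x // p x = 0} k[X]) :
    evenBlock _ p (ofMatrix (Matrix.diagonal d) (padMatrix p B)) =
      B * Matrix.diagonal fun x => d x.1 := by
  ext1 x y
  rw [evenBlock_apply, act_ofMatrix_one_single, Matrix.mul_diagonal, padMatrix, Matrix.of_apply,
    dif_pos ⟨x.2, y.2⟩]

/-- This divisibility by Q₀ is what denies the even block an identity, and it lets σ be read as a
map on the cofactors `B`. -/
theorem exists_evenBlock_eq (a : CendQ (Matrix.diagonal d)) :
    ∃ B, evenBlock _ p a = B * Matrix.diagonal fun x => d x.1 := by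
  obtain ⟨_, a, rfl⟩ := a
  refine ⟨Matrix.of fun x y => Cend.act a 1 (Pi.single y.1 1) x.1, ?_⟩
  ext1 x y
  rw [evenBlock_apply, Cend.sandwich_apply, Matrix.toLin'_apply, Matrix.diagonal_mulVec_single,
    Matrix.mul_diagonal]
  have h : (Pi.single y.1 (d y.1 * 1) : ι → k[X]) = d y.1 • Pi.single y.1 1 := by
    rw [← smul_eq_mul, Pi.single_smul]
  rw [h, Cend.act_one_smul]
  exact mul_comm _ _

/-! ### Involutions of the even part and conjugated multiplications. -/

/-- Involutions of the even part of `Cend_{N,Q}`. -/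
structure IsEvenInvolution (p : ι → ZMod 2) (σ : CendQ Q →ₗ[k] CendQ Q) : Prop where
  map_D : ∀ a, σ (D (k := k) a) = D (k := k) (σ a)
  map_mem : ∀ a ∈ parityPart Q p 0, σ a ∈ parityPart Q p 0
  invol : ∀ a, σ (σ a) = a
  map_prod : ∀ a ∈ parityPart Q p 0, ∀ b ∈ parityPart Q p 0, ∀ n,
    σ (prod (k := k) n a b) = braceProd k n (σ b) (σ a)

namespace IsEvenInvolution

section

variable {σ : CendQ Q →ₗ[k] CendQ Q}

theorem evenBlock_prod (H : IsEvenInvolution p σ) {a b : CendQ Q} (ha : a ∈ parityPart Q p 0) (hb : b ∈ parityPart Q p 0) :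
    evenBlock Q p (σ (prod (k := k) 0 a b)) = evenBlock Q p (σ b) * evenBlock Q p (σ a) := by
  rw [H.map_prod a ha b hb, evenBlock_braceProd _ (H.map_mem a ha)]

/-- Left multiplication affects only the left factor of the reversed product, and σ turns that
factor back into the right one. -/
theorem conj_leftX_prod (H : IsEvenInvolution p σ) {a b : CendQ Q} (ha : a ∈ parityPart Q p 0) (hb : b ∈ parityPart Q p 0)
    (n : ℕ) : σ (leftX Q (σ (prod (k := k) n a b))) =
      prod (k := k) n a (σ (leftX Q (σ b))) := by
  have h1 := H.map_prod a ha (σ (leftX Q (σ b))) (H.map_mem _ (leftX_mem (H.map_mem _ hb))) n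
  rw [H.invol] at h1
  rw [H.map_prod a ha b hb, map_braceProd (leftX Q) leftX_D (fun m => leftX_prod m _ _), ← h1,
    H.invol]

theorem conj_rightX_prod (H : IsEvenInvolution p σ) {a b : CendQ Q} (ha : a ∈ parityPart Q p 0) (hb : b ∈ parityPart Q p 0)
    (n : ℕ) : σ (rightX Q (σ (prod (k := k) n a b))) =
      prod (k := k) n (σ (rightX Q (σ a))) b := by
  have h1 := H.map_prod (σ (rightX Q (σ a))) (H.map_mem _ (rightX_mem (H.map_mem _ ha))) b hb n
  rw [H.invol] at h1
  rw [H.map_prod a ha b hb, map_braceProd (rightX Q) rightX_D (fun m => rightX_prod m _ _), ← h1,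
    H.invol]

/-- The two conjugates agree modulo the image of `D`, so there a single map commutes with both left
and right multiplications; the correction `D a` matters for the product of index 1. -/
theorem conj_rightX (H : IsEvenInvolution p σ) (a : CendQ Q) :
    σ (rightX Q (σ a)) = σ (leftX Q (σ a)) - D (k := k) a := by
  rw [rightX, LinearMap.sub_apply, map_sub, H.map_D, H.invol]

end

end IsEvenInvolution

end CendQ

/-! ### Invariance of the kernel of the even-even block. -/

namespace CendQ

open ConformalAlgebra

namespace IsEvenInvolution

variable {k : Type*} [Field k] [CharZero k] {ι : Type*} [Fintype ι] [DecidableEq ι]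
  {p : ι → ZMod 2} {d : ι → k[X]}
  {σ : CendQ (Matrix.diagonal d) →ₗ[k] CendQ (Matrix.diagonal d)}

/-- Elements with equal values at 1 differ by an element of the image of `D`, which σ preserves. -/
theorem act_one_congr (H : IsEvenInvolution p σ) (hd : ∀ x, d x ≠ 0)
    {a b : CendQ (Matrix.diagonal d)} (h : Cend.act a.1 1 = Cend.act b.1 1) :
    Cend.act (σ a).1 1 = Cend.act (σ b).1 1 := by
  obtain ⟨c, hc⟩ := exists_D_eq hd (a - b) (by
    rw [Submodule.coe_sub, map_sub, LinearMap.sub_apply, h, sub_self])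
  have h1 := congrArg σ hc
  rw [H.map_D, map_sub] at h1
  have h2 := act_D_one (σ c)
  rwa [h1, Submodule.coe_sub, map_sub, LinearMap.sub_apply, sub_eq_zero] at h2

/-- An even involution of `Cend_{N,Q}`, `Q = diag(v, 1, …, 1)`, preserves, modulo the image of
`D`, the even elements whose even-even block vanishes. -/
theorem evenBlock_eq_zero (H : IsEvenInvolution p σ) {o : ι} (hpo : p o = 0) (ho : d o = X)
    (hd : ∀ x, x ≠ o → d x = 1) {a : CendQ (Matrix.diagonal d)}
    (ha : a ∈ parityPart (Matrix.diagonal d) p 0) (h0 : evenBlock _ p a = 0) :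
    evenBlock _ p (σ a) = 0 := by
  have hd0 : ∀ x, d x ≠ 0 := fun x => by
    by_cases hx : x = o
    · rw [hx, ho]
      exact X_ne_zero
    · rw [hd x hx]
      exact one_ne_zero
  -- `u` lifts the central idempotent that projects onto V₁; it exists because the entry `X` of `Q`
  -- sits in the even block.
  set u := ofMatrix (Matrix.diagonal d) (Matrix.diagonal fun x => if p x = 1 then 1 else 0)
  have hu1 : ∀ v, Cend.act u.1 1 v = parityProj k p 1 v := fun v => by
    ext1 x
    rw [act_ofMatrix_one, Matrix.mulVec_diagonal, Matrix.mulVec_diagonal]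
    by_cases hx : p x = 1
    · have hxo : x ≠ o := by
        rintro rfl
        rw [hpo] at hx
        exact absurd hx (by decide)
      simp [parityProj, hx, hd x hxo]
    · simp [parityProj, hx]
  have hu : u ∈ parityPart (Matrix.diagonal d) p 0 := ofMatrix_mem diagonal_even diagonal_even
  have hcomm : ∀ x ∈ parityPart (Matrix.diagonal d) p 0, ∀ v,
      parityProj k p 1 (Cend.act x.1 1 v) = Cend.act x.1 1 (parityProj k p 1 v) := by
    intro x hx v
    have e0 := parityProj_of_mem p _ 1 _ (hx 1 0 _ (parityProj_mem p 0 v))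
    have e1 := parityProj_of_mem p _ 1 _ (hx 1 1 _ (parityProj_mem p 1 v))
    rw [if_neg (by decide)] at e0
    rw [if_pos (by decide)] at e1
    conv_lhs => rw [← parityProj_add p 0 v]
    rw [zero_add, map_add, map_add, e0, e1, zero_add]
  -- If the even block of `a` vanishes, then `a(1)` factors through V₁, where `u(1)` is the
  -- identity.
  have hua : Cend.act (prod (k := k) 0 u a : CendQ (Matrix.diagonal d)).1 1 = Cend.act a.1 1 := by
    refine LinearMap.ext fun v => ?_
    rw [act_prod_zero, hu1, hcomm a ha]
    conv_rhs => rw [← parityProj_add p 0 v]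
    rw [zero_add, map_add, right_eq_add]
    ext1 x
    by_cases hx : p x = 0
    · rw [act_one_apply_of_mem a (parityProj_mem p 0 v) ⟨x, hx⟩, h0]
      simp
    · exact ha 1 0 _ (parityProj_mem p 0 v) x hx
  set P := evenBlock _ p (σ u) with hP
  have hPP : P * P = P := by
    rw [hP, ← H.evenBlock_prod hu hu]
    refine evenBlock_congr (H.act_one_congr hd0 (LinearMap.ext fun v => ?_))
    rw [act_prod_zero, hu1, hu1, parityProj_of_mem p 1 1 _ (parityProj_mem p 1 v), if_pos rfl]
  have hPx : ∀ x ∈ parityPart (Matrix.diagonal d) p 0,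
      evenBlock _ p (σ x) * P = P * evenBlock _ p (σ x) := fun x hx => by
    rw [hP, ← H.evenBlock_prod hu hx, ← H.evenBlock_prod hx hu]
    refine evenBlock_congr (H.act_one_congr hd0 (LinearMap.ext fun v => ?_))
    rw [act_prod_zero, act_prod_zero, hu1, hu1, hcomm x hx]
  have hPB : ∀ B, B * Matrix.diagonal (fun x : {x // p x = 0} => d x.1) * P =
      P * (B * Matrix.diagonal fun x : {x // p x = 0} => d x.1) := fun B => by
    have := hPx _ (H.map_mem (ofMatrix (Matrix.diagonal d) (padMatrix p B))
      (ofMatrix_mem diagonal_even (padMatrix_even B)))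
    rwa [H.invol, evenBlock_ofMatrix_padMatrix] at this
  -- `P` commutes with nonzero multiples of all matrix units, so it is a scalar `q` with `q² = q`.
  -- As an even block it has `(o, o)` entry divisible by `X`, which rules out `q = 1`.
  have hP0 : P = 0 := by
    obtain ⟨q, hq⟩ := Matrix.mem_range_scalar_iff_commute_single'.2 fun i j => by
      have h1 : Matrix.single i j 1 * Matrix.diagonal (fun x : {x // p x = 0} => d x.1) =
          d j.1 • Matrix.single i j 1 := by
        ext x y
        by_cases hy : j = y
        · subst hy
          simp [Matrix.mul_diagonal, mul_comm]
        · simp [Matrix.mul_diagonal, hy]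
      have h2 := hPB (Matrix.single i j 1)
      rw [h1, Matrix.smul_mul, Matrix.mul_smul] at h2
      change Matrix.single i j 1 * P = P * Matrix.single i j 1
      ext1 x y
      exact mul_left_cancel₀ (hd0 j.1) (congrFun (congrFun h2 x) y)
    have hPq : ∀ x, P x x = q := fun x => by rw [← hq]; simp
    have hqq : q * q = q := by
      have := congrFun (congrFun hPP ⟨o, hpo⟩) ⟨o, hpo⟩
      rw [← hq, ← map_mul] at this
      simpa using this
    obtain ⟨B, hB⟩ := exists_evenBlock_eq (p := p) (σ u)
    have hXq : q = B ⟨o, hpo⟩ ⟨o, hpo⟩ * X := by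
      rw [← hPq ⟨o, hpo⟩, hP, hB, Matrix.mul_diagonal, ho]
    have hq0 : q = 0 := by
      by_contra hne
      have h1 : q = 1 := mul_left_cancel₀ hne (hqq.trans (mul_one q).symm)
      rw [h1] at hXq
      exact not_isUnit_X (IsUnit.of_mul_eq_one_right _ hXq.symm)
    rw [← hq, hq0, map_zero]
  rw [← evenBlock_congr (H.act_one_congr hd0 hua), H.evenBlock_prod hu ha, ← hP, hP0, mul_zero]

end IsEvenInvolution

end CendQ

/-! ### The twist of the scalars by a polynomial with derivative -1. -/

namespace CendQ

open ConformalAlgebra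

section

variable {k : Type*} [Field k] {ι : Type*} [Fintype ι] [DecidableEq ι]
  {p : ι → ZMod 2} {d : ι → k[X]}

theorem act_ofMatrix_padMatrix_single (j : {x // p x = 0}) (hj : d j.1 = 1) (h : k[X])
    (v : ι → k[X]) :
    Cend.act (ofMatrix (Matrix.diagonal d) (padMatrix p (Matrix.single j j 1))).1 h v =
      Pi.single j.1 (aeval (derivative : Module.End k k[X]) h (v j.1)) := by
  have h1 : padMatrix p (Matrix.single j j (1 : k[X])) = Matrix.single j.1 j.1 1 := by
    ext1 x y
    rw [padMatrix, Matrix.of_apply]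
    split_ifs with hxy
    · simp [Matrix.single_apply, Subtype.ext_iff]
    · rw [Matrix.single_apply, if_neg]
      rintro ⟨rfl, rfl⟩
      exact hxy ⟨j.2, j.2⟩
  rw [h1, act_ofMatrix, Matrix.single_mulVec, act_one_apply, Matrix.mulVec_diagonal, hj]
  simp only [one_mul]
  ext1 x
  by_cases hx : x = j.1
  · subst hx
    simp
  · simp [hx]

theorem prod_mem {a b : CendQ (Matrix.diagonal d)} (n : ℕ)
    (ha : a ∈ parityPart (Matrix.diagonal d) p 0) (hb : b ∈ parityPart (Matrix.diagonal d) p 0) :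
    prod (k := k) n a b ∈ parityPart (Matrix.diagonal d) p 0 :=
  (grading (Matrix.diagonal d) p diagonal_even).prod_mem 0 0 n a b ha hb

theorem ofMatrix_padMatrix_mem (B : Matrix {x // p x = 0} {x // p x = 0} k[X]) :
    ofMatrix (Matrix.diagonal d) (padMatrix p B) ∈ parityPart (Matrix.diagonal d) p 0 :=
  ofMatrix_mem diagonal_even (padMatrix_even B)

end

namespace IsEvenInvolution

variable {k : Type*} [Field k] [CharZero k] {ι : Type*} [Fintype ι] [DecidableEq ι]
  {p : ι → ZMod 2} {d : ι → k[X]}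
  {σ : CendQ (Matrix.diagonal d) →ₗ[k] CendQ (Matrix.diagonal d)}

theorem evenBlock_congr (H : IsEvenInvolution p σ) {o : ι} (hpo : p o = 0) (ho : d o = X)
    (hd : ∀ x, x ≠ o → d x = 1) {a b : CendQ (Matrix.diagonal d)}
    (ha : a ∈ parityPart (Matrix.diagonal d) p 0) (hb : b ∈ parityPart (Matrix.diagonal d) p 0)
    (hab : evenBlock _ p a = evenBlock _ p b) : evenBlock _ p (σ a) = evenBlock _ p (σ b) := by
  have := H.evenBlock_eq_zero hpo ho hd (Submodule.sub_mem _ ha hb) (by rw [map_sub, hab, sub_self])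
  rwa [map_sub, map_sub, sub_eq_zero] at this

/-- The conjugate of left multiplication by `D` is thus well defined on even blocks. -/
theorem evenBlock_conj_congr (H : IsEvenInvolution p σ) {o : ι} (hpo : p o = 0) (ho : d o = X)
    (hd : ∀ x, x ≠ o → d x = 1) {a b : CendQ (Matrix.diagonal d)}
    (ha : a ∈ parityPart (Matrix.diagonal d) p 0) (hb : b ∈ parityPart (Matrix.diagonal d) p 0)
    (hab : evenBlock _ p a = evenBlock _ p b) :
    evenBlock _ p (σ (leftX _ (σ a))) = evenBlock _ p (σ (leftX _ (σ b))) :=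
  H.evenBlock_congr hpo ho hd (leftX_mem (H.map_mem _ ha)) (leftX_mem (H.map_mem _ hb)) (by
    rw [evenBlock_leftX, evenBlock_leftX, H.evenBlock_congr hpo ho hd ha hb hab])

theorem evenBlock_conj_rightX (H : IsEvenInvolution p σ) (a : CendQ (Matrix.diagonal d)) :
    evenBlock _ p (σ (rightX _ (σ a))) = evenBlock _ p (σ (leftX _ (σ a))) := by
  rw [H.conj_rightX, map_sub, evenBlock_D, sub_zero]

/-- The lift ε of a diagonal unit satisfies ε ∘₁ ε = 0 modulo the image of `D`. The conjugated
multiplication can be moved onto either factor, and the two resulting equations differ by the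
correction `D ε`. -/
theorem derivative_evenBlock_conj_leftX (H : IsEvenInvolution p σ) {o : ι} (hpo : p o = 0)
    (ho : d o = X) (hd : ∀ x, x ≠ o → d x = 1) (j : {x // p x = 0}) (hjo : j.1 ≠ o) :
    derivative (evenBlock _ p (σ (leftX _ (σ
      (ofMatrix (Matrix.diagonal d) (padMatrix p (Matrix.single j j 1)))))) j j) = -1 := by
  have hact := act_ofMatrix_padMatrix_single (k := k) j (hd _ hjo)
  have hεm := ofMatrix_padMatrix_mem (d := d) (Matrix.single j j (1 : k[X]))
  generalize ofMatrix (Matrix.diagonal d) (padMatrix p (Matrix.single j j 1)) = ε at hact hεm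
  -- At 1 the product is the commutator of ε(X) and ε(1), which act on component `j` as
  -- differentiation and the identity.
  have h0 : evenBlock (Matrix.diagonal d) p (prod (k := k) 1 ε ε) =
      evenBlock (Matrix.diagonal d) p 0 := by
    refine CendQ.evenBlock_congr (LinearMap.ext fun v => ?_)
    rw [act_prod_one, hact, hact, hact, hact]
    simp
  have h1 := H.evenBlock_conj_congr hpo ho hd (prod_mem 1 hεm hεm) (Submodule.zero_mem _) h0
  simp only [map_zero] at h1
  have h2 := h1
  rw [← H.evenBlock_conj_rightX, H.conj_rightX_prod hεm hεm] at h2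
  rw [H.conj_leftX_prod hεm hεm] at h1
  have e1 := congrFun (congrFun h1 j) j
  have e2 := congrFun (congrFun h2 j) j
  rw [evenBlock_apply, act_prod_one, Pi.sub_apply, hact, hact, Pi.single_eq_same,
    Pi.single_eq_same, ← evenBlock_apply] at e1
  rw [evenBlock_apply, act_prod_one, hact, hact, H.conj_rightX, Submodule.coe_sub, coe_D,
    map_sub] at e2
  simp only [mul_one, aeval_X, map_one, Module.End.one_apply, Pi.single_eq_same, derivative_one,
    Pi.single_zero, map_zero, sub_zero, LinearMap.sub_apply, Cend.deriv_apply, derivative_X,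
    sub_neg_eq_add, Pi.add_apply, hact, Matrix.zero_apply] at e1 e2
  -- The unknown `(j, j)` entry of the conjugate at `X` has opposite signs in `e1` and `e2`; the
  -- summand 1 comes from `D ε` at `X`.
  linear_combination e1 + e2

set_option maxHeartbeats 800000 in
/-- Conjugation by the involution turns left multiplication by `D` into a multiplication, modulo the
image of the derivation, by a polynomial with derivative `-1`. -/
theorem exists_conj_leftX (H : IsEvenInvolution p σ) {o j : ι} (hpo : p o = 0) (hpj : p j = 0)
    (hjo : j ≠ o) (ho : d o = X) (hd : ∀ x, x ≠ o → d x = 1) :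
    ∃ q : k[X], derivative q = -1 ∧ ∀ a ∈ parityPart (Matrix.diagonal d) p 0,
      evenBlock _ p (σ (leftX _ (σ a))) = q • evenBlock _ p a := by
  have hd0 : ∀ x, d x ≠ 0 := fun x => by
    by_cases hx : x = o
    · rw [hx, ho]
      exact X_ne_zero
    · rw [hd x hx]
      exact one_ne_zero
  lift j to {x // p x = 0} using hpj
  have hcongr : ∀ {a b : CendQ (Matrix.diagonal d)}, a ∈ parityPart (Matrix.diagonal d) p 0 →
      b ∈ parityPart (Matrix.diagonal d) p 0 → evenBlock _ p a = evenBlock _ p b →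
      evenBlock _ p (σ (leftX _ (σ a))) = evenBlock _ p (σ (leftX _ (σ b))) :=
    fun ha hb hab => H.evenBlock_conj_congr hpo ho hd ha hb hab
  have hright := H.evenBlock_conj_rightX
  have hleftmem : ∀ {a}, a ∈ parityPart (Matrix.diagonal d) p 0 →
      σ (leftX _ (σ a)) ∈ parityPart (Matrix.diagonal d) p 0 :=
    fun ha => H.map_mem _ (leftX_mem (H.map_mem _ ha))
  have hl : ∀ {a b}, a ∈ parityPart (Matrix.diagonal d) p 0 →
      b ∈ parityPart (Matrix.diagonal d) p 0 →
      evenBlock _ p (σ (leftX _ (σ (prod (k := k) 0 a b)))) =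
        evenBlock _ p a * evenBlock _ p (σ (leftX _ (σ b))) := fun ha hb => by
    rw [H.conj_leftX_prod ha hb, CendQ.evenBlock_prod _ (hleftmem hb)]
  have hr : ∀ {a b}, a ∈ parityPart (Matrix.diagonal d) p 0 →
      b ∈ parityPart (Matrix.diagonal d) p 0 →
      evenBlock _ p (σ (leftX _ (σ (prod (k := k) 0 a b)))) =
        evenBlock _ p (σ (leftX _ (σ a))) * evenBlock _ p b := fun ha hb => by
    rw [← hright, H.conj_rightX_prod ha hb, CendQ.evenBlock_prod _ hb, hright]
  set D := Matrix.diagonal fun x : {x // p x = 0} => d x.1 with hD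
  set ε := ofMatrix (Matrix.diagonal d) (padMatrix p (Matrix.single j j 1)) with hε
  have hεm : ε ∈ parityPart (Matrix.diagonal d) p 0 := ofMatrix_padMatrix_mem _
  have hSD : ∀ i, Matrix.single j i 1 * D = d i.1 • Matrix.single j i 1 := fun i => by
    ext1 x y
    by_cases hy : i = y
    · subst hy
      simp [hD, Matrix.mul_diagonal, mul_comm]
    · simp [hD, Matrix.mul_diagonal, hy]
  have hρε : evenBlock _ p ε = Matrix.single j j 1 := by
    rw [hε, evenBlock_ofMatrix_padMatrix, hSD, hd _ hjo, one_smul]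
  set Y := evenBlock _ p (σ (leftX _ (σ ε))) with hY
  have hεε : evenBlock _ p (prod (k := k) 0 ε ε) = evenBlock _ p ε := by
    rw [CendQ.evenBlock_prod _ hεm, hρε, Matrix.single_mul_single_same, mul_one]
  have hYl : Y = Matrix.single j j 1 * Y := by
    rw [hY, ← hρε, ← hl hεm hεm]
    exact hcongr hεm (prod_mem 0 hεm hεm) hεε.symm
  have hYr : Y = Y * Matrix.single j j 1 := by
    rw [hY, ← hρε, ← hr hεm hεm]
    exact hcongr hεm (prod_mem 0 hεm hεm) hεε.symm
  -- The corner of `j` consists of scalar multiples of the unit, which produces the polynomial `q`.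
  have hYq : Y = Y j j • Matrix.single j j 1 := by
    conv_lhs => rw [hYr, hYl, Matrix.single_mul_mul_single]
    simp [Matrix.smul_single]
  refine ⟨Y j j, ?_, fun a ha => ?_⟩
  · rw [hY, hε]
    exact H.derivative_evenBlock_conj_leftX hpo ho hd j hjo
  · ext1 i y
    -- The lift `x` of the unit `(j, i)` carries row `i` of the block of `a` to row `j`; moving the
    -- conjugated multiplication across `x` and `a` compares the two rows up to the nonzero factor
    -- `d i`.
    have hx := ofMatrix_padMatrix_mem (d := d) (p := p) (Matrix.single j i 1)
    set x := ofMatrix (Matrix.diagonal d) (padMatrix p (Matrix.single j i 1)) with hxdef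
    have hρx : evenBlock _ p x = d i.1 • Matrix.single j i 1 := by
      rw [hxdef, evenBlock_ofMatrix_padMatrix, hSD]
    have h1 : evenBlock _ p (prod (k := k) 0 ε x) = evenBlock _ p x := by
      rw [CendQ.evenBlock_prod _ hx, hρε, hρx, Matrix.mul_smul, Matrix.single_mul_single_same,
        mul_one]
    have h2 : evenBlock _ p (σ (leftX _ (σ x))) = Y j j • evenBlock _ p x := by
      rw [← hcongr (prod_mem 0 hεm hx) hx h1, hr hεm hx, ← hY, hYq, Matrix.smul_mul, ← hρε,
        ← CendQ.evenBlock_prod _ hx, h1]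
      simp [hρε]
    have h3 := (hl hx ha).symm.trans (hr hx ha)
    rw [h2, hρx] at h3
    have h4 := congrFun (congrFun h3 j) y
    simp only [Matrix.smul_mul, Matrix.smul_apply, Matrix.single_mul_apply_same, smul_eq_mul,
      one_mul] at h4
    rw [Matrix.smul_apply, smul_eq_mul]
    refine mul_left_cancel₀ (hd0 i.1) ?_
    rw [h4]
    ring

/-! ### The contradiction for an even number of even basis vectors. -/

/-- The even part of `Cend_{N,Q}`, `Q = diag(v, 1, …, 1)`, has no involution if the number of even
basis vectors is even. -/
theorem not_even_card (H : IsEvenInvolution p σ) {o j : ι} (hpo : p o = 0) (hpj : p j = 0)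
    (hjo : j ≠ o) (ho : d o = X) (hd : ∀ x, x ≠ o → d x = 1) :
    ¬ Even (Fintype.card {x // p x = 0}) := by
  intro heven
  obtain ⟨q, hq, hφ⟩ := H.exists_conj_leftX hpo hpj hjo ho hd
  set D := Matrix.diagonal fun x : {x // p x = 0} => d x.1 with hD
  have hcancel : ∀ A B : Matrix {x // p x = 0} {x // p x = 0} k[X], A * D = B * D → A = B := by
    intro A B h
    ext1 x y
    have h1 := congrFun (congrFun h x) y
    rw [hD, Matrix.mul_diagonal, Matrix.mul_diagonal] at h1
    refine mul_right_cancel₀ ?_ h1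
    by_cases hy : y.1 = o
    · rw [hy, ho]
      exact X_ne_zero
    · rw [hd _ hy]
      exact one_ne_zero
  set L : Matrix {x // p x = 0} {x // p x = 0} k[X] → CendQ (Matrix.diagonal d) :=
    fun A => ofMatrix (Matrix.diagonal d) (padMatrix p A) with hL
  have hLm : ∀ A, L A ∈ parityPart (Matrix.diagonal d) p 0 := ofMatrix_padMatrix_mem
  have hρL : ∀ A, evenBlock _ p (L A) = A * D := evenBlock_ofMatrix_padMatrix
  -- `τ` is σ read through the injection A ↦ A Q₀, whose image consists of all even blocks.
  choose τ hτ using fun A => exists_evenBlock_eq (p := p) (σ (L A))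
  have key : ∀ {a A}, a ∈ parityPart (Matrix.diagonal d) p 0 → evenBlock _ p a = A * D →
      evenBlock _ p (σ a) = τ A * D := fun {a A} ha h => by
    rw [← hτ]
    exact H.evenBlock_congr hpo ho hd ha (hLm A) (h.trans (hρL A).symm)
  have τ_add : ∀ A B, τ (A + B) = τ A + τ B := fun A B => hcancel _ _ (by
    rw [Matrix.add_mul, ← hτ A, ← hτ B, ← map_add, ← map_add]
    refine (key (Submodule.add_mem _ (hLm A) (hLm B)) ?_).symm
    rw [map_add, hρL, hρL, Matrix.add_mul])
  have τ_C : ∀ (r : k) A, τ (r • A) = r • τ A := fun r A => hcancel _ _ (by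
    rw [Matrix.smul_mul, ← hτ A, ← map_smul, ← map_smul]
    refine (key (Submodule.smul_mem _ r (hLm A)) ?_).symm
    rw [map_smul, hρL, Matrix.smul_mul])
  -- Applying `hφ` to σ(L A) and cancelling σ² leaves σ applied to the left multiple of `L A`.
  have τ_X : ∀ A, τ ((X : k[X]) • A) = q • τ A := fun A => hcancel _ _ (by
    rw [Matrix.smul_mul, ← hτ A, ← hφ _ (H.map_mem _ (hLm A)), H.invol]
    refine (key (leftX_mem (hLm A)) ?_).symm
    rw [evenBlock_leftX, hρL, Matrix.smul_mul])
  have τ_smul : ∀ (r : k[X]) A, τ (r • A) = aeval q r • τ A := fun r => by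
    induction r using Polynomial.induction_on with
    | C r =>
      intro A
      rw [aeval_C, algebraMap_smul, ← τ_C, ← mul_one (C r), ← smul_eq_C_mul, smul_assoc, one_smul]
    | add r s hr hs => intro A; rw [add_smul, τ_add, hr, hs, map_add, add_smul]
    | monomial m r ih =>
      intro A
      have : C r * X ^ (m + 1) = (C r * X ^ m) * X := by ring
      rw [this, mul_smul, ih, τ_X, map_mul _ _ X, aeval_X, mul_smul]
  have hX := Matrix.eq_X_of_antiinvolution (θ := aeval q) (τ := AddMonoidHom.mk' τ τ_add) heven
    ⟨o, hpo⟩ ⟨j, hpj⟩ (fun h => hjo (congrArg Subtype.val h)) (d := fun x => d x.1) ho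
    (fun x hx => hd x.1 fun h => hx (Subtype.ext h)) τ_smul
    (fun A B => hcancel _ _ (by
      change τ (A * D * B) * D = τ B * D * τ A * D
      rw [Matrix.mul_assoc _ (τ A), ← hτ A, ← hτ B, ← H.evenBlock_prod (hLm A) (hLm B)]
      refine (key (prod_mem 0 (hLm A) (hLm B)) ?_).symm
      rw [CendQ.evenBlock_prod _ (hLm B), hρL, hρL, Matrix.mul_assoc _ B]))
    (fun A => hcancel _ _ (by
      change τ (τ A) * D = A * D
      rw [← key (H.map_mem _ (hLm A)) (hτ A), H.invol, hρL]))
  rw [aeval_X] at hX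
  rw [hX, derivative_X] at hq
  have h2 : (2 : k[X]) = 0 := by linear_combination hq
  exact two_ne_zero h2

end IsEvenInvolution

end CendQ

/-! ### Parity of the number of even monomials and the conclusion. -/

/-- Symmetric difference with a fixed two-element set is an involution without fixed points that
preserves the parity of the cardinality. -/
theorem even_card_filter_even_card (n : ℕ) (hn : 1 < n) :
    Even (Fintype.card {s : Finset (Fin n) // ((s.card : ℕ) : ZMod 2) = 0}) := by
  have hpair : (({⟨0, by omega⟩, ⟨1, hn⟩} : Finset (Fin n))).card = 2 :=
    Finset.card_pair (by simp)
  set t : Finset (Fin n) := {⟨0, by omega⟩, ⟨1, hn⟩} with ht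
  have hcard : ∀ s : Finset (Fin n), ((symmDiff s t).card : ZMod 2) = s.card := fun s => by
    have h1 : (symmDiff s t).card + 2 * (s ∩ t).card = s.card + t.card := by
      have h2 := Finset.card_sdiff_add_card_inter s t
      have h3 := Finset.card_sdiff_add_card_inter t s
      rw [Finset.inter_comm] at h3
      rw [symmDiff_def, Finset.sup_eq_union,
        Finset.card_union_of_disjoint (disjoint_sdiff_sdiff)]
      omega
    have h2 := congrArg (Nat.cast : ℕ → ZMod 2) h1
    push_cast [hpair] at h2
    have h3 : (2 : ZMod 2) = 0 := by decide
    simpa [h3] using h2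
  rw [← ZMod.natCast_eq_zero_iff_even, Fintype.card_subtype, Finset.card_eq_sum_ones,
    Nat.cast_sum]
  refine Finset.sum_involution (fun s _ => symmDiff s t) (fun s _ => by decide) (fun s _ _ h => ?_)
    (fun s hs => ?_) (fun s _ => symmDiff_symmDiff_cancel_right _ _)
  · rw [symmDiff_eq_left, Finset.bot_eq_empty] at h
    rw [h] at hpair
    simp at hpair
  · rw [Finset.mem_filter] at hs ⊢
    exact ⟨Finset.mem_univ _, (hcard s).trans hs.2⟩

theorem mainTheorem4 {k : Type*} [Field k] [CharZero k] (n : ℕ) (hn : 1 < n)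
    (e : Fin (2 ^ n) ≃ Finset (Fin n)) (he : ∀ x : Fin (2 ^ n), (x : ℕ) = 0 → e x = ∅) :
    ¬ ∃ σ : CendQ (diagV k (2 ^ n)) →ₗ[k] CendQ (diagV k (2 ^ n)),
      ConformalAlgebra.IsSuperinvolution (exteriorGrading k n e) σ := by
  rintro ⟨σ, hσ⟩
  have H : CendQ.IsEvenInvolution (fun x => ((e x).card : ZMod 2)) σ :=
    { map_D := hσ.map_D
      map_mem := hσ.map_part 0
      invol := hσ.invol
      map_prod := fun a ha b hb m => by
        have := hσ.map_prod 0 0 a b ha hb m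
        rwa [ZMod.val_zero, mul_zero, pow_zero, one_smul] at this }
  have hpair : (({⟨0, by omega⟩, ⟨1, hn⟩} : Finset (Fin n))).card = 2 :=
    Finset.card_pair (by simp)
  set t : Finset (Fin n) := {⟨0, by omega⟩, ⟨1, hn⟩} with ht
  set o : Fin (2 ^ n) := ⟨0, by positivity⟩
  have hto : e.symm t ≠ o := fun h => by
    have h1 := he (e.symm t) (by rw [h])
    rw [Equiv.apply_symm_apply] at h1
    rw [h1] at hpair
    simp at hpair
  -- The second even basis vector is the monomial ξ₁ξ₂, available because `n > 1`.
  refine CendQ.IsEvenInvolution.not_even_card H (o := o) (j := e.symm t) ?_ ?_ hto ?_ ?_ ?_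
  · rw [he o rfl]
    simp
  · rw [Equiv.apply_symm_apply, hpair]
    decide
  · simp [o]
  · intro x hx
    rw [if_neg fun h => hx (Fin.ext h)]
  · have := even_card_filter_even_card n hn
    rwa [← Fintype.card_congr (Equiv.subtypeEquiv e fun x => Iff.rfl)] at this
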